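/- Let $\Bbbk$ be a field, $A$ a commutative $\Bbbk$-algebra and $R$ an $A$-ring, i.e. a $\Bbbk$-algebra with an algebra map $A\to R$ (whose image need not be central). Bimodules are $\Bbbk$-central. An $A$-coring is a comonoid $(C,\Delta,\varepsilon)$ in $A$-bimodules, with $\Delta(c)=c_1\otimes_A c_2$. Let $R^*=\mathrm{Hom}_{-A}(R,A)$ be the right $A$-linear dual, an $A$-bimodule via $(afb)(r)=a f(br)$. Let $\mathcal{A}_R$ be the full subcategory of right $R$-modules whose underlying right $A$-module is finitely generated and projective, and for an $A$-coring $C$ let $\mathcal{A}^C$ be the full subcategory of right $C$-comodules whose underlying right $A$-module is finitely generated and projective. Call an $A$-bimodule map $f:C\to R^*$ from an $A$-coring *compatible* if $f(c)(xy)=f(c_1)\big(f(c_2)(x)\,y\big)$ and $f(c)(1)=\varepsilon(c)$ for all $c\in C$, $x,y\in R$. Let $\xi:R^\bullet\to R^*$ be the universal compatible map: for every $A$-coring $C$ and every compatible $f:C\to R^*$ there is a unique morphism of $A$-corings $\hat f:C\to R^\bullet$ with $\xi\circ\hat f=f$. Let $R^\circ$ be the infinite comatrix coring of (a small skeleton of)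 $\mathcal{A}_R$, i.e. $\big(\bigoplus_{P\in\mathcal{A}_R}P^*\otimes_{\mathrm{End}_R(P)}P\big)$ modulo the relations $q^*\otimes tp=q^*t\otimes p$ for $t\in\mathrm{Hom}_R(P,Q)$, $q^*\in Q^*=\mathrm{Hom}_{-A}(Q,A)$, $p\in P$, with $\Delta(\overline{p^*\otimes p})=\sum_i\overline{p^*\otimes e_i}\otimes_A\overline{e_i^*\otimes p}$ (for a dual basis $\{e_i,e_i^*\}$ of $P$) and $\varepsilon(\overline{p^*\otimes p})=p^*(p)$. Let $\zeta:R^\circ\to R^*$ be the compatible map $\overline{p^*\otimes p}\mapsto[r\mapsto p^*(pr)]$, and let $\hat\zeta:R^\circ\to R^\bullet$ be the induced morphism of corings. Let $\mathcal{L}':\mathcal{A}^{R^\bullet}\to\mathcal{A}_R$ be the functor that sends $(M,\varrho)$, $\varrho(m)=m_{(0)}\otimes_A m_{(1)}$, to $M$ with $m\cdot r=m_{(0)}\,\xi(m_{(1)})(r)$. Let $\chi:\mathcal{A}_R\to\mathcal{A}^{R^\circ}$ be the functor that sends $P$ to its underlying $A$-module with coaction $p\mapsto\sum_i e_i\otimes_A\overline{e_i^*\otimes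 p}$, and let $\chi'=\mathcal{A}^{\hat\zeta}\circ\chi:\mathcal{A}_R\to\mathcal{A}^{R^\bullet}$, where $\mathcal{A}^{\hat\zeta}$ is corestriction along $\hat\zeta$. All these functors are the identity on underlying maps. Then $R^\bullet$ exists, and the functors $\mathcal{L}'$ and $\chi'$ are mutually inverse isomorphisms of categories between $\mathcal{A}^{R^\bullet}$ and $\mathcal{A}_R$: $\chi'\circ\mathcal{L}'=\mathrm{id}$ and $\mathcal{L}'\circ\chi'=\mathrm{id}$. -/

import Mathlib

universe u

open CategoryTheory

namespace FiniteDual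

open MulOpposite
open scoped TensorProduct DirectSum

/-! ### The balanced tensor product of a right module and a left module

Right `A`-modules are modules over `Aᵐᵒᵖ`, so `m a` is `op a • m`. An `A`-bimodule carries commuting
actions of `A` and of `Aᵐᵒᵖ`. -/

section Balanced

variable (A : Type*) [Ring A]

/-- The relations `m a ⊗ n = m ⊗ a n`. -/
def balancedRel (M N : Type*) [AddCommGroup M] [AddCommGroup N] [Module Aᵐᵒᵖ M] [Module A N] :
    Submodule ℤ (M ⊗[ℤ] N) :=
  Submodule.span ℤ {x | ∃ (m : M) (a : A) (n : N), x = (op a • m) ⊗ₜ[ℤ] n - m ⊗ₜ[ℤ] (a • n)}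

/-- The tensor product `M ⊗_A N` of a right `A`-module and a left `A`-module. -/
def BTensor (M N : Type*) [AddCommGroup M] [AddCommGroup N] [Module Aᵐᵒᵖ M] [Module A N] : Type _ :=
  (M ⊗[ℤ] N) ⧸ balancedRel A M N

namespace BTensor

variable {M M' N N' L P : Type*} [AddCommGroup M] [AddCommGroup M'] [AddCommGroup N]
  [AddCommGroup N'] [AddCommGroup L] [AddCommGroup P]
  [Module Aᵐᵒᵖ M] [Module Aᵐᵒᵖ M'] [Module A N] [Module A N'] [Module A L]

instance : AddCommGroup (BTensor A M N) :=
  inferInstanceAs (AddCommGroup ((M ⊗[ℤ] N) ⧸ balancedRel A M N))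

/-- The pure tensor `m ⊗_A n`. -/
def tmul (m : M) (n : N) : BTensor A M N := (balancedRel A M N).mkQ (m ⊗ₜ[ℤ] n)

theorem add_tmul (m m' : M) (n : N) : tmul A (m + m') n = tmul A m n + tmul A m' n := by
  simp only [tmul, TensorProduct.add_tmul, map_add]; rfl

theorem tmul_add (m : M) (n n' : N) : tmul A m (n + n') = tmul A m n + tmul A m n' := by
  simp only [tmul, TensorProduct.tmul_add, map_add]; rfl

theorem smul_tmul (a : A) (m : M) (n : N) : tmul A (op a • m) n = tmul A m (a • n) := by
  refine (Submodule.Quotient.eq _).2 (Submodule.subset_span ⟨m, a, n, rfl⟩)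

/-- The universal property: an additive map out of `M ⊗_A N` from a balanced biadditive map. -/
def lift (f : M → N → P) (hl : ∀ m m' n, f (m + m') n = f m n + f m' n)
    (hr : ∀ m n n', f m (n + n') = f m n + f m n')
    (hb : ∀ (m : M) (a : A) (n : N), f (op a • m) n = f m (a • n)) : BTensor A M N →+ P :=
  ((balancedRel A M N).liftQ
    (TensorProduct.liftAddHom
      (AddMonoidHom.mk' (fun m => AddMonoidHom.mk' (f m) (hr m))
        (fun m m' => AddMonoidHom.ext (hl m m')))
      (fun r m n => by
        have h1 := map_zsmul (AddMonoidHom.mk' (f m) (hr m)) r n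
        have h2 := map_zsmul (AddMonoidHom.mk' (fun m => f m n) (fun m m' => hl m m' n)) r m
        exact h2.trans h1.symm)).toIntLinearMap
    (by
      refine Submodule.span_le.2 ?_
      rintro _ ⟨m, a, n, rfl⟩
      exact (map_sub _ _ _).trans (sub_eq_zero.2 (hb m a n)))).toAddMonoidHom

@[simp]
theorem lift_tmul (f : M → N → P) (hl) (hr) (hb) (m : M) (n : N) :
    lift A f hl hr hb (tmul A m n) = f m n := rfl

variable {A}

theorem hom_ext {f g : BTensor A M N →+ P} (h : ∀ m n, f (tmul A m n) = g (tmul A m n)) : f = g := by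
  ext x
  obtain ⟨x, rfl⟩ := (balancedRel A M N).mkQ_surjective x
  induction x with
  | zero => exact (map_zero f).trans (map_zero g).symm
  | tmul m n => exact h m n
  | add x y hx hy =>
    have e : (balancedRel A M N).mkQ (x + y)
      = ((balancedRel A M N).mkQ x : BTensor A M N) + (balancedRel A M N).mkQ y := map_add _ _ _
    exact (congrArg f e).trans ((map_add f _ _).trans ((congrArg₂ (· + ·) hx hy).trans
      ((map_add g _ _).symm.trans (congrArg g e).symm)))

theorem hom_congr {f g : BTensor A M N →+ P} (h : ∀ m n, f (tmul A m n) = g (tmul A m n))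
    (x : BTensor A M N) : f x = g x := DFunLike.congr_fun (hom_ext h) x

theorem tmul_sum {ι : Type*} (s : Finset ι) (m : M) (n : ι → N) :
    tmul A m (∑ i ∈ s, n i) = ∑ i ∈ s, tmul A m (n i) :=
  map_sum (AddMonoidHom.mk' (fun n => tmul A m n) (tmul_add A m)) n s

theorem sum_tmul {ι : Type*} (s : Finset ι) (m : ι → M) (n : N) :
    tmul A (∑ i ∈ s, m i) n = ∑ i ∈ s, tmul A (m i) n :=
  map_sum (AddMonoidHom.mk' (fun m => tmul A m n) (fun m m' => add_tmul A m m' n)) m s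

/-- `f ⊗_A g`. -/
def map (f : M →ₗ[Aᵐᵒᵖ] M') (g : N →ₗ[A] N') : BTensor A M N →+ BTensor A M' N' :=
  lift A (fun m n => tmul A (f m) (g n)) (fun m m' n => by rw [map_add, add_tmul])
    (fun m n n' => by rw [map_add, tmul_add])
    (fun m a n => by rw [map_smul, map_smul, smul_tmul])

@[simp]
theorem map_tmul (f : M →ₗ[Aᵐᵒᵖ] M') (g : N →ₗ[A] N') (m : M) (n : N) :
    map f g (tmul A m n) = tmul A (f m) (g n) := rfl

/-- Left multiplication on the left factor. -/
def lsmulHom [Module A M] [SMulCommClass A Aᵐᵒᵖ M] (a : A) : BTensor A M N →+ BTensor A M N :=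
  lift A (fun m n => tmul A (a • m) n) (fun m m' n => by rw [smul_add, add_tmul])
    (fun m n n' => by rw [tmul_add])
    (fun m b n => by rw [smul_comm, smul_tmul])

/-- Right multiplication on the right factor. -/
def rsmulHom [Module Aᵐᵒᵖ N] [SMulCommClass A Aᵐᵒᵖ N] (a : Aᵐᵒᵖ) :
    BTensor A M N →+ BTensor A M N :=
  lift A (fun m n => tmul A m (a • n)) (fun m m' n => by rw [add_tmul])
    (fun m n n' => by rw [smul_add, tmul_add])
    (fun m b n => by rw [smul_tmul, smul_comm])

/-- If `M` is a bimodule then `M ⊗_A N` is a left module: `a (m ⊗ n) = a m ⊗ n`. -/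
instance [Module A M] [SMulCommClass A Aᵐᵒᵖ M] : Module A (BTensor A M N) where
  smul a x := lsmulHom a x
  one_smul := hom_congr (f := lsmulHom 1) (g := .id _)
    fun m n => congrArg (tmul A · n) (one_smul A m)
  mul_smul a b := hom_congr (f := lsmulHom (a * b)) (g := (lsmulHom a).comp (lsmulHom b))
    fun m n => congrArg (tmul A · n) (mul_smul a b m)
  smul_zero a := map_zero (lsmulHom a)
  smul_add a := map_add (lsmulHom a)
  add_smul a b := hom_congr (f := lsmulHom (a + b)) (g := lsmulHom a + lsmulHom b)
    fun m n => (congrArg (tmul A · n) (add_smul a b m)).trans (add_tmul A _ _ n)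
  zero_smul := hom_congr (f := lsmulHom 0) (g := 0) fun m n => by
    have := map_zero (AddMonoidHom.mk' (fun m : M => tmul A m n) (fun m m' => add_tmul A m m' n))
    simpa [lsmulHom] using this

/-- If `N` is a bimodule then `M ⊗_A N` is a right module: `(m ⊗ n) a = m ⊗ n a`. -/
instance [Module Aᵐᵒᵖ N] [SMulCommClass A Aᵐᵒᵖ N] : Module Aᵐᵒᵖ (BTensor A M N) where
  smul a x := rsmulHom a x
  one_smul := hom_congr (f := rsmulHom 1) (g := .id _)
    fun m n => congrArg (tmul A m ·) (one_smul Aᵐᵒᵖ n)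
  mul_smul a b := hom_congr (f := rsmulHom (a * b)) (g := (rsmulHom a).comp (rsmulHom b))
    fun m n => congrArg (tmul A m ·) (mul_smul a b n)
  smul_zero a := map_zero (rsmulHom a)
  smul_add a := map_add (rsmulHom a)
  add_smul a b := hom_congr (f := rsmulHom (a + b)) (g := rsmulHom a + rsmulHom b)
    fun m n => (congrArg (tmul A m ·) (add_smul a b n)).trans (tmul_add A m _ _)
  zero_smul := hom_congr (f := rsmulHom 0) (g := 0) fun m n => by
    have := map_zero (AddMonoidHom.mk' (fun n : N => tmul A m n) (tmul_add A m))
    simpa [rsmulHom] using this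

@[simp]
theorem lsmul_tmul [Module A M] [SMulCommClass A Aᵐᵒᵖ M] (a : A) (m : M) (n : N) :
    a • tmul A m n = tmul A (a • m) n := rfl

@[simp]
theorem rsmul_tmul [Module Aᵐᵒᵖ N] [SMulCommClass A Aᵐᵒᵖ N] (a : Aᵐᵒᵖ) (m : M) (n : N) :
    a • tmul A m n = tmul A m (a • n) := rfl

instance [Module A M] [SMulCommClass A Aᵐᵒᵖ M] [Module Aᵐᵒᵖ N] [SMulCommClass A Aᵐᵒᵖ N] :
    SMulCommClass A Aᵐᵒᵖ (BTensor A M N) where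
  smul_comm a b := hom_congr (f := (lsmulHom a).comp (rsmulHom b))
    (g := (rsmulHom b).comp (lsmulHom a)) fun _ _ => rfl

/-- The map `n ⊗ l ↦ (m ⊗ n) ⊗ l`. -/
def assocAux [Module Aᵐᵒᵖ N] [SMulCommClass A Aᵐᵒᵖ N] (m : M) :
    BTensor A N L →+ BTensor A (BTensor A M N) L :=
  lift A (fun n l => tmul A (tmul A m n) l)
    (fun n n' l => by rw [tmul_add, add_tmul])
    (fun n l l' => by rw [tmul_add])
    (fun n a l => by rw [← rsmul_tmul, smul_tmul])

variable (A) in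
/-- The associativity `M ⊗_A (N ⊗_A L) → (M ⊗_A N) ⊗_A L`, `m ⊗ (n ⊗ l) ↦ (m ⊗ n) ⊗ l`. -/
def assoc (M N L : Type*) [AddCommGroup M] [AddCommGroup N] [AddCommGroup L] [Module Aᵐᵒᵖ M]
    [Module A N] [Module Aᵐᵒᵖ N] [SMulCommClass A Aᵐᵒᵖ N] [Module A L] :
    BTensor A M (BTensor A N L) →+ BTensor A (BTensor A M N) L :=
  lift A (fun m t => assocAux m t)
    (fun m m' => hom_congr (f := assocAux (m + m')) (g := assocAux m + assocAux m') fun n l => by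
      change tmul A (tmul A (m + m') n) l = tmul A (tmul A m n) l + tmul A (tmul A m' n) l
      rw [add_tmul, add_tmul])
    (fun m => map_add _)
    (fun m a => hom_congr (f := assocAux (op a • m)) (g := (assocAux m).comp (lsmulHom a))
      fun n l => by
        change tmul A (tmul A (op a • m) n) l = tmul A (tmul A m (a • n)) l
        rw [smul_tmul])

@[simp]
theorem assoc_tmul [Module Aᵐᵒᵖ N] [SMulCommClass A Aᵐᵒᵖ N] (m : M) (n : N) (l : L) :
    assoc A M N L (tmul A m (tmul A n l)) = tmul A (tmul A m n) l := rfl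

variable (A) in
/-- The identification `A ⊗_A N = N`. -/
def lid (N : Type*) [AddCommGroup N] [Module A N] : BTensor A A N →+ N :=
  lift A (fun a n => a • n) (fun _ _ _ => add_smul _ _ _) (fun _ _ _ => smul_add _ _ _)
    (fun a b n => mul_smul a b n)

variable (A) in
/-- The identification `M ⊗_A A = M`. -/
def rid (M : Type*) [AddCommGroup M] [Module Aᵐᵒᵖ M] : BTensor A M A →+ M :=
  lift A (fun m a => op a • m) (fun _ _ _ => smul_add _ _ _)
    (fun _ _ _ => by rw [MulOpposite.op_add, add_smul])
    (fun m a b => by rw [smul_eq_mul, MulOpposite.op_mul, mul_smul])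

@[simp]
theorem lid_tmul (a : A) (n : N) : lid A N (tmul A a n) = a • n := rfl

@[simp]
theorem rid_tmul (m : M) (a : A) : rid A M (tmul A m a) = op a • m := rfl

end BTensor

/-- Morphisms of `A`-bimodules. -/
structure BimodHom (X Y : Type*) [AddCommGroup X] [AddCommGroup Y] [Module A X] [Module Aᵐᵒᵖ X]
    [Module A Y] [Module Aᵐᵒᵖ Y] extends X →+ Y where
  map_lsmul : ∀ (a : A) (x : X), toFun (a • x) = a • toFun x
  map_rsmul : ∀ (a : Aᵐᵒᵖ) (x : X), toFun (a • x) = a • toFun x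

namespace BimodHom

variable {A} {X Y : Type*} [AddCommGroup X] [AddCommGroup Y] [Module A X] [Module Aᵐᵒᵖ X]
    [Module A Y] [Module Aᵐᵒᵖ Y]

instance : CoeFun (BimodHom A X Y) (fun _ => X → Y) := ⟨fun f => f.toFun⟩

/-- The underlying left `A`-linear map. -/
def left (f : BimodHom A X Y) : X →ₗ[A] Y where
  toFun := f
  map_add' := f.map_add'
  map_smul' := f.map_lsmul

/-- The underlying right `A`-linear map. -/
def right (f : BimodHom A X Y) : X →ₗ[Aᵐᵒᵖ] Y where
  toFun := f
  map_add' := f.map_add'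
  map_smul' := f.map_rsmul

@[simp]
theorem left_apply (f : BimodHom A X Y) (x : X) : f.left x = f x := rfl

@[simp]
theorem right_apply (f : BimodHom A X Y) (x : X) : f.right x = f x := rfl

end BimodHom

end Balanced

/-- `f ⊗_A g` as a left linear map, for a bimodule map `f`. -/
def BTensor.mapLeft {A : Type*} [Ring A] {X Y N N' : Type*} [AddCommGroup X] [AddCommGroup Y]
    [AddCommGroup N] [AddCommGroup N'] [Module A X] [Module Aᵐᵒᵖ X] [SMulCommClass A Aᵐᵒᵖ X]
    [Module A Y] [Module Aᵐᵒᵖ Y] [SMulCommClass A Aᵐᵒᵖ Y] [Module A N] [Module A N']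
    (f : BimodHom A X Y) (g : N →ₗ[A] N') : BTensor A X N →ₗ[A] BTensor A Y N' where
  toFun := BTensor.map f.right g
  map_add' := map_add _
  map_smul' a := BTensor.hom_congr (f := (BTensor.map f.right g).comp (BTensor.lsmulHom a))
    (g := (BTensor.lsmulHom a).comp (BTensor.map f.right g))
    fun x n => congrArg (BTensor.tmul A · (g n)) (f.map_lsmul a x)

/-- `f ⊗_A g` as a right linear map, for a bimodule map `g`. -/
def BTensor.mapRight {A : Type*} [Ring A] {X Y M M' : Type*} [AddCommGroup X] [AddCommGroup Y]
    [AddCommGroup M] [AddCommGroup M'] [Module A X] [Module Aᵐᵒᵖ X] [SMulCommClass A Aᵐᵒᵖ X]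
    [Module A Y] [Module Aᵐᵒᵖ Y] [SMulCommClass A Aᵐᵒᵖ Y] [Module Aᵐᵒᵖ M] [Module Aᵐᵒᵖ M']
    (f : M →ₗ[Aᵐᵒᵖ] M') (g : BimodHom A X Y) : BTensor A M X →ₗ[Aᵐᵒᵖ] BTensor A M' Y where
  toFun := BTensor.map f g.left
  map_add' := map_add _
  map_smul' a := BTensor.hom_congr (f := (BTensor.map f g.left).comp (BTensor.rsmulHom a))
    (g := (BTensor.rsmulHom a).comp (BTensor.map f g.left))
    fun m x => congrArg (BTensor.tmul A (f m)) (g.map_rsmul a x)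

/-! ### Corings, comodules, `A`-rings -/

section Corings

variable (k A : Type u) [Field k] [CommRing A] [Algebra k A]

/-- An `A`-coring: a comonoid in the category of `k`-central `A`-bimodules. -/
structure Coring where
  carrier : Type u
  [addCommGroup : AddCommGroup carrier]
  [leftModule : Module A carrier]
  [rightModule : Module Aᵐᵒᵖ carrier]
  [smulComm : SMulCommClass A Aᵐᵒᵖ carrier]
  central : ∀ (r : k) (c : carrier), algebraMap k A r • c = op (algebraMap k A r) • c
  comul : BimodHom A carrier (BTensor A carrier carrier)
  counit : BimodHom A carrier A
  coassoc : ∀ c, BTensor.map comul.right LinearMap.id (comul c) =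
    BTensor.assoc A carrier carrier carrier (BTensor.map LinearMap.id comul.left (comul c))
  counit_left : ∀ c, BTensor.lid A carrier (BTensor.map counit.right LinearMap.id (comul c)) = c
  counit_right : ∀ c, BTensor.rid A carrier (BTensor.map LinearMap.id counit.left (comul c)) = c

attribute [instance] Coring.addCommGroup Coring.leftModule Coring.rightModule Coring.smulComm

variable {k A}

instance : CoeSort (Coring k A) (Type u) := ⟨Coring.carrier⟩

/-- Morphisms of `A`-corings. -/
structure CoringHom (C D : Coring k A) extends BimodHom A C D where
  map_comul : ∀ c, D.comul (toFun c) = BTensor.map toBimodHom.right toBimodHom.left (C.comul c)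
  map_counit : ∀ c, D.counit (toFun c) = C.counit c

instance (C D : Coring k A) : CoeFun (CoringHom C D) (fun _ => C → D) := ⟨fun f => f.toFun⟩

/-- Right `A`-modules that are finitely generated and projective. -/
def IsFGP (M : ModuleCat.{u} Aᵐᵒᵖ) : Prop := Module.Finite Aᵐᵒᵖ M ∧ Module.Projective Aᵐᵒᵖ M

/-- Right `C`-comodules. -/
structure Comod (C : Coring k A) where
  toMod : ModuleCat.{u} Aᵐᵒᵖ
  coact : toMod →ₗ[Aᵐᵒᵖ] BTensor A toMod C
  coassoc : ∀ m, BTensor.map coact LinearMap.id (coact m) =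
    BTensor.assoc A toMod C C (BTensor.map LinearMap.id C.comul.left (coact m))
  counit : ∀ m, BTensor.rid A toMod (BTensor.map LinearMap.id C.counit.left (coact m)) = m

/-- Morphisms of right `C`-comodules: the colinear right `A`-linear maps. -/
@[ext]
structure Comod.Hom {C : Coring k A} (M N : Comod C) where
  lin : M.toMod →ₗ[Aᵐᵒᵖ] N.toMod
  colinear : ∀ m, N.coact (lin m) = BTensor.map lin LinearMap.id (M.coact m)

instance (C : Coring k A) : Category (Comod C) where
  Hom := Comod.Hom
  id M := ⟨LinearMap.id, fun m => BTensor.hom_congr (f := .id _)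
    (g := BTensor.map LinearMap.id LinearMap.id) (fun _ _ => rfl) (M.coact m)⟩
  comp {M N P} f g := ⟨g.lin.comp f.lin, fun m => by
    change P.coact (g.lin (f.lin m)) = _
    rw [g.colinear, f.colinear]
    exact BTensor.hom_congr
      (f := (BTensor.map g.lin LinearMap.id).comp (BTensor.map f.lin LinearMap.id))
      (g := BTensor.map (g.lin.comp f.lin) LinearMap.id) (fun _ _ => rfl) (M.coact m)⟩

/-- The category `𝒜^C` of right `C`-comodules that are finitely generated and projective over `A`,
a full subcategory of all right `C`-comodules. -/
abbrev FGPComod (C : Coring k A) : Type (u + 1) :=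
  ObjectProperty.FullSubcategory (fun M : Comod C => IsFGP M.toMod)

/-- The coaction `(M ⊗_A g) ∘ ϱ`. -/
def Comod.induceCoact {C D : Coring k A} (g : CoringHom C D) (M : Comod C) :
    M.toMod →ₗ[Aᵐᵒᵖ] BTensor A M.toMod D :=
  (BTensor.mapRight LinearMap.id g.toBimodHom).comp M.coact

/-- Corestriction of comodules along a morphism of corings, `ϱ ↦ (M ⊗_A g) ∘ ϱ`. -/
def Comod.induce {C D : Coring k A} (g : CoringHom C D) (M : Comod C) : Comod D where
  toMod := M.toMod
  coact := M.induceCoact g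
  coassoc m := by
    have h1 : BTensor.map (M.induceCoact g) (LinearMap.id : D →ₗ[A] D)
          (BTensor.map LinearMap.id g.left (M.coact m)) =
        (BTensor.map (BTensor.mapRight LinearMap.id g.toBimodHom) g.left)
          (BTensor.map M.coact LinearMap.id (M.coact m)) :=
      BTensor.hom_congr (f := (BTensor.map (M.induceCoact g) LinearMap.id).comp (BTensor.map LinearMap.id g.left))
        (g := (BTensor.map (BTensor.mapRight LinearMap.id g.toBimodHom) g.left).comp
          (BTensor.map M.coact LinearMap.id))
        (fun _ _ => rfl) (M.coact m)
    have h2 : ∀ t : BTensor A M.toMod (BTensor A C C),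
        (BTensor.map (BTensor.mapRight LinearMap.id g.toBimodHom) g.left)
          (BTensor.assoc A M.toMod C C t) =
        BTensor.assoc A M.toMod D D
          (BTensor.map LinearMap.id (BTensor.mapLeft g.toBimodHom g.left) t) := by
      refine BTensor.hom_congr
        (f := (BTensor.map (BTensor.mapRight LinearMap.id g.toBimodHom) g.left).comp
          (BTensor.assoc A M.toMod C C))
        (g := (BTensor.assoc A M.toMod D D).comp
          (BTensor.map LinearMap.id (BTensor.mapLeft g.toBimodHom g.left))) fun m => ?_
      exact BTensor.hom_congr
        (f := (BTensor.map (BTensor.mapRight LinearMap.id g.toBimodHom) g.left).comp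
          (BTensor.assocAux m))
        (g := (BTensor.assocAux m).comp (BTensor.map g.right g.left)) fun _ _ => rfl
    change BTensor.map (M.induceCoact g) LinearMap.id (BTensor.map LinearMap.id g.left (M.coact m)) =
      BTensor.assoc A M.toMod D D (BTensor.map LinearMap.id D.comul.left
        (BTensor.map LinearMap.id g.left (M.coact m)))
    rw [h1, M.coassoc, h2]
    congr 1
    exact BTensor.hom_congr
      (f := (BTensor.map LinearMap.id (BTensor.mapLeft g.toBimodHom g.left)).comp
        (BTensor.map LinearMap.id C.comul.left))
      (g := (BTensor.map LinearMap.id D.comul.left).comp (BTensor.map LinearMap.id g.left))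
      (fun m c => congrArg (BTensor.tmul A m) (g.map_comul c).symm) (M.coact m)
  counit m := by
    conv_rhs => rw [← M.counit m]
    exact BTensor.hom_congr
      (f := (BTensor.rid A M.toMod).comp ((BTensor.map LinearMap.id D.counit.left).comp
        (BTensor.map LinearMap.id g.left)))
      (g := (BTensor.rid A M.toMod).comp (BTensor.map LinearMap.id C.counit.left))
      (fun m c => congrArg (fun a : A => op a • m) (g.map_counit c)) (M.coact m)

/-- A colinear map stays colinear after corestriction. -/
def Comod.induceHom {C D : Coring k A} (g : CoringHom C D) {M N : Comod C} (f : Comod.Hom M N) :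
    Comod.Hom (M.induce g) (N.induce g) where
  lin := f.lin
  colinear m := by
    refine (congrArg (BTensor.map LinearMap.id g.left) (f.colinear m)).trans ?_
    exact BTensor.hom_congr
      (f := (BTensor.map LinearMap.id g.left).comp (BTensor.map f.lin LinearMap.id))
      (g := (BTensor.map f.lin LinearMap.id).comp (BTensor.map LinearMap.id g.left))
      (fun _ _ => rfl) (M.coact m)

/-- The functor `𝒜^g : 𝒜^C ⥤ 𝒜^D` induced by a morphism of corings `g : C → D`. -/
def FGPComod.induce {C D : Coring k A} (g : CoringHom C D) : FGPComod C ⥤ FGPComod D where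
  obj M := ⟨M.obj.induce g, M.property⟩
  map {M N} f := ObjectProperty.homMk (Comod.induceHom g f.hom)

end Corings

/-! ### The right dual of an `A`-ring and the ring action on comodules -/

section Rings

variable {k A R : Type u} [Field k] [CommRing A] [Algebra k A] [Ring R] [Algebra k R]

/-- The right dual `R^* = Hom_{-A}(R, A)` of an `A`-ring `φ : A → R`. -/
def RDual (φ : A →ₐ[k] R) : AddSubgroup (R →+ A) where
  carrier := {f | ∀ (r : R) (a : A), f (r * φ a) = f r * a}
  zero_mem' r a := by simp
  add_mem' {_ _} hf hg r a := by simp [hf r a, hg r a, add_mul]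
  neg_mem' {_} hf r a := by simp [hf r a]

namespace RDual

variable {φ : A →ₐ[k] R}

instance : FunLike (RDual φ) R A where
  coe f := f.1
  coe_injective _ _ h := Subtype.ext (DFunLike.coe_injective h)

instance : AddMonoidHomClass (RDual φ) R A where
  map_add f := f.1.map_add
  map_zero f := f.1.map_zero

theorem map_mul_right (f : RDual φ) (r : R) (a : A) : f (r * φ a) = f r * a := f.2 r a

@[ext]
theorem ext {f g : RDual φ} (h : ∀ r, f r = g r) : f = g := DFunLike.ext f g h

@[simp]
theorem add_apply (f g : RDual φ) (r : R) : (f + g) r = f r + g r := rfl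

@[simp]
theorem zero_apply (r : R) : (0 : RDual φ) r = 0 := rfl

/-- `(a f)(r) = a f(r)`. -/
instance : Module A (RDual φ) where
  smul a f := ⟨(AddMonoidHom.mulLeft a).comp f.1, fun r b => by
    change a * f (r * φ b) = a * f r * b
    rw [map_mul_right, mul_assoc]⟩
  one_smul f := ext fun r => one_mul (f r)
  mul_smul a b f := ext fun r => mul_assoc a b (f r)
  smul_zero a := ext fun _ => mul_zero a
  smul_add a f g := ext fun r => mul_add a (f r) (g r)
  add_smul a b f := ext fun r => add_mul a b (f r)
  zero_smul f := ext fun r => zero_mul (f r)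

/-- `(f b)(r) = f(b r)`. -/
instance : Module Aᵐᵒᵖ (RDual φ) where
  smul b f := ⟨f.1.comp (AddMonoidHom.mulLeft (φ b.unop)), fun r a => by
    change f (φ b.unop * (r * φ a)) = f (φ b.unop * r) * a
    rw [← mul_assoc, map_mul_right]⟩
  one_smul f := ext fun r => by
    change f (φ 1 * r) = f r
    rw [map_one, one_mul]
  mul_smul a b f := ext fun r => by
    change f (φ (b.unop * a.unop) * r) = f (φ b.unop * (φ a.unop * r))
    rw [map_mul φ, mul_assoc]
  smul_zero _ := rfl
  smul_add _ _ _ := rfl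
  add_smul a b f := ext fun r => by
    change f (φ (a.unop + b.unop) * r) = f (φ a.unop * r) + f (φ b.unop * r)
    rw [map_add, add_mul, map_add]
  zero_smul f := ext fun r => by
    change f (φ 0 * r) = 0
    rw [map_zero, zero_mul, map_zero]

@[simp]
theorem lsmul_apply (a : A) (f : RDual φ) (r : R) : (a • f) r = a * f r := rfl

@[simp]
theorem rsmul_apply (b : A) (f : RDual φ) (r : R) : (op b • f) r = f (φ b * r) := rfl

end RDual

/-- A bimodule map `f : C → R^*`, evaluated at `r`, is left `A`-linear. -/
def evalAt {φ : A →ₐ[k] R} {C : Coring k A} (f : BimodHom A C (RDual φ)) (r : R) : C →ₗ[A] A where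
  toFun c := f c r
  map_add' c d := by rw [f.map_add']; rfl
  map_smul' a c := by rw [f.map_lsmul]; rfl

/-- For a bimodule map `f : C → R^*` and `x y : R`, the additive map `C ⊗_A C → A`,
`c ⊗ d ↦ f(c)(f(d)(x) y)`. -/
def convAt {φ : A →ₐ[k] R} {C : Coring k A} (f : BimodHom A C (RDual φ)) (x y : R) :
    BTensor A C C →+ A :=
  BTensor.lift A (fun c d => f c (φ (f d x) * y))
    (fun c c' d => by rw [f.map_add']; rfl)
    (fun c d d' => by rw [f.map_add', RDual.add_apply, map_add, add_mul, map_add])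
    (fun c a d => by
      rw [f.map_rsmul, f.map_lsmul, RDual.lsmul_apply, RDual.rsmul_apply, map_mul φ, mul_assoc])

/-- The conditions `f(c)(x y) = f(c₁)(f(c₂)(x) y)` and `f(c)(1) = ε(c)` on a bimodule map
`f : C → R^*` from an `A`-coring (`f(a c b)(u) = a f(c)(b u)` is bilinearity). -/
structure IsDualPairing {φ : A →ₐ[k] R} {C : Coring k A} (f : BimodHom A C (RDual φ)) : Prop where
  map_mul : ∀ (c : C) (x y : R), f c (x * y) = convAt f x y (C.comul c)
  map_one : ∀ c : C, f c 1 = C.counit c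

/-- The right `A`-module underlying a right `R`-module. -/
noncomputable abbrev underlying (φ : A →ₐ[k] R) : ModuleCat.{u} Rᵐᵒᵖ ⥤ ModuleCat.{u} Aᵐᵒᵖ :=
  ModuleCat.restrictScalars (φ : A →+* R).op

/-- The category `𝒜_R` of right `R`-modules that are finitely generated and projective over `A`,
a full subcategory of all right `R`-modules. -/
abbrev FGPMod (φ : A →ₐ[k] R) : Type (u + 1) :=
  ObjectProperty.FullSubcategory (fun M : ModuleCat.{u} Rᵐᵒᵖ => IsFGP ((underlying φ).obj M))

section Action

variable {φ : A →ₐ[k] R} {C : Coring k A} (f : BimodHom A C (RDual φ))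

/-- The map `m ⊗ c ↦ m f(c)(r)`. -/
def actAux (M : Type u) [AddCommGroup M] [Module Aᵐᵒᵖ M] (r : R) : BTensor A M C →+ M :=
  (BTensor.rid A M).comp (BTensor.map LinearMap.id (evalAt f r))

/-- The right action `m · r = m₍₀₎ f(m₍₁₎)(r)` of `R` on a right `C`-comodule. -/
def comodAct (M : Comod C) (r : R) (m : M.toMod) : M.toMod := actAux f M.toMod r (M.coact m)

theorem actAux_coact (M : Comod C) (r : R) (t : BTensor A M.toMod C) :
    M.coact (actAux f M.toMod r t) = actAux f _ r (BTensor.map M.coact LinearMap.id t) :=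
  BTensor.hom_congr (f := M.coact.toAddMonoidHom.comp (actAux f M.toMod r))
    (g := (actAux f _ r).comp (BTensor.map M.coact LinearMap.id))
    (fun m c => M.coact.map_smul (op (f c r)) m) t

theorem actAux_assoc (M : Type u) [AddCommGroup M] [Module Aᵐᵒᵖ M] (x y : R) (m : M)
    (d : BTensor A C C) :
    actAux f M y (actAux f _ x (BTensor.assoc A M C C (BTensor.tmul A m d))) =
      op (convAt f x y d) • m :=
  BTensor.hom_congr (f := (actAux f M y).comp ((actAux f _ x).comp (BTensor.assocAux m)))
    (g := AddMonoidHom.comp (AddMonoidHom.mk' (fun a : A => op a • m)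
      (fun a b => by rw [MulOpposite.op_add, add_smul])) (convAt f x y))
    (fun c d => by
      change op (f (op (f d x) • c) y) • m = op (f c (φ (f d x) * y)) • m
      rw [f.map_rsmul, RDual.rsmul_apply]) d

variable {f}

theorem comodAct_mul (hf : IsDualPairing f) (M : Comod C) (x y : R) (m : M.toMod) :
    comodAct f M (x * y) m = comodAct f M y (comodAct f M x m) := by
  unfold comodAct
  rw [actAux_coact, M.coassoc]
  refine BTensor.hom_congr (f := actAux f M.toMod (x * y))
    (g := (actAux f M.toMod y).comp ((actAux f _ x).comp
      ((BTensor.assoc A M.toMod C C).comp (BTensor.map LinearMap.id C.comul.left))))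
    (fun m c => ?_) (M.coact m)
  change op (f c (x * y)) • m = actAux f M.toMod y (actAux f _ x (BTensor.assoc A M.toMod C C
    (BTensor.tmul A m (C.comul c))))
  rw [actAux_assoc, hf.map_mul]

theorem comodAct_map (hf : IsDualPairing f) (M : Comod C) (a : A) (m : M.toMod) :
    comodAct f M (φ a) m = op a • m := by
  conv_rhs => rw [← M.counit m]
  refine BTensor.hom_congr (f := actAux f M.toMod (φ a))
    (g := AddMonoidHom.comp (DistribSMul.toAddMonoidHom M.toMod (op a))
      ((BTensor.rid A M.toMod).comp (BTensor.map LinearMap.id C.counit.left)))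
    (fun m c => ?_) (M.coact m)
  change op (f c (φ a)) • m = op a • op (C.counit c) • m
  rw [← one_mul (φ a), RDual.map_mul_right, hf.map_one, MulOpposite.op_mul, mul_smul]

/-- The right `R`-module structure `m · r = m₍₀₎ f(m₍₁₎)(r)` on a right `C`-comodule. -/
@[reducible]
def comodModule (hf : IsDualPairing f) (M : Comod C) : Module Rᵐᵒᵖ M.toMod where
  smul r m := comodAct f M r.unop m
  one_smul m := by
    change comodAct f M 1 m = m
    rw [← map_one φ, comodAct_map hf, op_one, one_smul]
  mul_smul x y m := comodAct_mul hf M y.unop x.unop m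
  smul_zero r := by
    change actAux f M.toMod r.unop (M.coact 0) = 0
    rw [map_zero, map_zero]
  smul_add r m n := by
    change actAux f M.toMod r.unop (M.coact (m + n)) = _
    rw [map_add, map_add]; rfl
  add_smul x y m := BTensor.hom_congr (f := actAux f M.toMod (x.unop + y.unop))
    (g := actAux f M.toMod x.unop + actAux f M.toMod y.unop) (fun m c => by
      change op (f c (x.unop + y.unop)) • m = op (f c x.unop) • m + op (f c y.unop) • m
      rw [map_add, MulOpposite.op_add, add_smul]) (M.coact m)
  zero_smul m := BTensor.hom_congr (f := actAux f M.toMod 0) (g := 0) (fun m c => by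
      change op (f c 0) • m = 0
      rw [map_zero, MulOpposite.op_zero, zero_smul]) (M.coact m)

/-- A right `C`-comodule, as a right `R`-module. -/
def comodToMod (hf : IsDualPairing f) (M : Comod C) : ModuleCat.{u} Rᵐᵒᵖ :=
  @ModuleCat.of Rᵐᵒᵖ _ M.toMod _ (comodModule hf M)

theorem isFGP_comodToMod (hf : IsDualPairing f) (M : Comod C) (h : IsFGP M.toMod) :
    IsFGP ((underlying φ).obj (comodToMod hf M)) := by
  let e : M.toMod ≃ₗ[Aᵐᵒᵖ] (underlying φ).obj (comodToMod hf M) :=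
    { AddEquiv.refl M.toMod with
      map_smul' := fun a m => (comodAct_map hf M a.unop m).symm }
  have := h.1
  have := h.2
  exact ⟨Module.Finite.equiv e, Module.Projective.of_equiv e⟩

theorem lin_comodAct (f : BimodHom A C (RDual φ)) {M N : Comod C} (g : Comod.Hom M N) (r : R)
    (m : M.toMod) : g.lin (comodAct f M r m) = comodAct f N r (g.lin m) := by
  unfold comodAct
  rw [g.colinear]
  exact BTensor.hom_congr (f := g.lin.toAddMonoidHom.comp (actAux f M.toMod r))
    (g := (actAux f N.toMod r).comp (BTensor.map g.lin LinearMap.id))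
    (fun m c => g.lin.map_smul (op (f c r)) m) (M.coact m)

/-- A colinear map is `R`-linear. -/
def comodToModHom (hf : IsDualPairing f) {M N : Comod C} (g : Comod.Hom M N) :
    comodToMod hf M ⟶ comodToMod hf N :=
  ModuleCat.ofHom (X := comodToMod hf M) (Y := comodToMod hf N)
    { toFun := g.lin
      map_add' := g.lin.map_add
      map_smul' := fun r m => lin_comodAct f g r.unop m }

/-- The functor `𝒜^C ⥤ 𝒜_R` that sends a comodule `M` to the same right `A`-module with the
`R`-action `m · r = m₍₀₎ f(m₍₁₎)(r)`, and is the identity on underlying maps. -/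
def comodToModFunctor (hf : IsDualPairing f) : FGPComod C ⥤ FGPMod φ where
  obj M := ⟨comodToMod hf M.obj, isFGP_comodToMod hf M.obj M.property⟩
  map g := ObjectProperty.homMk (comodToModHom hf g.hom)

end Action
end Rings

/-! ### The coring `R^•` -/

section Saft

variable {k A R : Type u} [Field k] [CommRing A] [Algebra k A] [Ring R] [Algebra k R]

/-- The coring `R^•` of an `A`-ring `φ : A → R`, together with `ξ : R^• → R^*`: the universal
`A`-coring with a bimodule map to `R^*` that satisfies `IsDualPairing`. -/
structure SaftDual (φ : A →ₐ[k] R) where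
  coring : Coring k A
  ξ : BimodHom A coring (RDual φ)
  pairing : IsDualPairing ξ
  universal : ∀ (C : Coring k A) (f : BimodHom A C (RDual φ)), IsDualPairing f →
    ∃! g : CoringHom C coring, ∀ c, ξ (g c) = f c

/-- The coring morphism `f̂ : C → R^•` with `ξ ∘ f̂ = f`. -/
noncomputable def SaftDual.hat {φ : A →ₐ[k] R} (D : SaftDual φ) {C : Coring k A}
    (f : BimodHom A C (RDual φ)) (hf : IsDualPairing f) : CoringHom C D.coring :=
  (D.universal C f hf).choose

end Saft

/-! ### The finite dual `R^∘` -/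

section Circ

variable {k A R : Type u} [Field k] [CommRing A] [Algebra k A] [Ring R] [Algebra k R]

/-- A finite dual basis `{e_i, e_i^*}` of a right `A`-module: `∑ e_i e_i^*(p) = p`. -/
structure DualBasis (P : ModuleCat.{u} Aᵐᵒᵖ) where
  n : ℕ
  e : Fin n → P
  e' : Fin n → (P →ₗ[Aᵐᵒᵖ] A)
  sum_eq : ∀ p, ∑ i, op (e' i p) • e i = p

theorem exists_dualBasis (P : ModuleCat.{u} Aᵐᵒᵖ) (h : IsFGP P) : Nonempty (DualBasis P) := by
  have := h.1
  have := h.2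
  obtain ⟨n, π, hπ⟩ := Module.Finite.exists_fin' Aᵐᵒᵖ P
  obtain ⟨s, hs⟩ := LinearMap.exists_rightInverse_of_surjective π (LinearMap.range_eq_top.2 hπ)
  let u : Aᵐᵒᵖ →ₗ[Aᵐᵒᵖ] A :=
    { toFun := unop
      map_add' := fun _ _ => rfl
      map_smul' := fun a b => rfl }
  refine ⟨n, fun i => π (Pi.single i 1), fun i => u.comp ((LinearMap.proj i).comp s), fun p => ?_⟩
  have h1 : π (s p) = p := DFunLike.congr_fun hs p
  conv_rhs => rw [← h1, ← Finset.univ_sum_single (s p), map_sum]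
  refine Finset.sum_congr rfl fun i _ => ?_
  rw [← map_smul]
  congr 1
  rw [← Pi.single_smul, smul_eq_mul, mul_one]
  rfl

theorem finite_of_isFGP {φ : A →ₐ[k] R} (M : FGPMod φ) : Module.Finite Rᵐᵒᵖ M.obj := by
  obtain ⟨n, e, e', h⟩ := exists_dualBasis _ M.property
  refine Module.Finite.of_surjective
    (Fintype.linearCombination Rᵐᵒᵖ (fun i => (e i : M.obj))) fun p =>
      ⟨fun i => op (φ (e' i p)), h p⟩

instance (φ : A →ₐ[k] R) : EssentiallySmall.{u} (FGPMod φ) := by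
  have h : (fun M : ModuleCat.{u} Rᵐᵒᵖ => IsFGP ((underlying φ).obj M)) ≤
    ModuleCat.isFG.{u} Rᵐᵒᵖ := fun M hM => finite_of_isFGP ⟨M, hM⟩
  have := (ObjectProperty.fullyFaithfulιOfLE h).full
  have := (ObjectProperty.fullyFaithfulιOfLE h).faithful
  exact essentiallySmall_of_fully_faithful (D := FGModuleCat.{u} Rᵐᵒᵖ) (ObjectProperty.ιOfLE h)

variable {φ : A →ₐ[k] R}

/-- The right `A`-module underlying an object of `𝒜_R`. -/
noncomputable abbrev FGPMod.toMod (M : FGPMod φ) : ModuleCat.{u} Aᵐᵒᵖ := (underlying φ).obj M.obj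

/-- The right `A`-linear map underlying a morphism of `𝒜_R`. -/
noncomputable abbrev FGPMod.toLin {M N : FGPMod φ} (t : M ⟶ N) : M.toMod →ₗ[Aᵐᵒᵖ] N.toMod :=
  ((underlying φ).map t.hom).hom

/-- The right action of `R` on an object of `𝒜_R`, as endomorphisms of the additive group. -/
noncomputable def FGPMod.ract (M : FGPMod φ) (r : R) : M.toMod →+ M.toMod :=
  AddMonoidHom.mk' (fun p => (op r • (p : M.obj) : M.obj)) (fun p q => smul_add (op r) (p : M.obj) q)

theorem FGPMod.ract_map (M : FGPMod φ) (a : A) (p : M.toMod) : M.ract (φ a) p = op a • p := rfl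

theorem FGPMod.ract_mul (M : FGPMod φ) (x y : R) (p : M.toMod) :
    M.ract (x * y) p = M.ract y (M.ract x p) := mul_smul (op y) (op x) (p : M.obj)

theorem FGPMod.ract_add (M : FGPMod φ) (x y : R) (p : M.toMod) :
    M.ract (x + y) p = M.ract x p + M.ract y p := add_smul (op x) (op y) (p : M.obj)

theorem FGPMod.toLin_ract {M N : FGPMod φ} (t : M ⟶ N) (r : R) (p : M.toMod) :
    FGPMod.toLin t (M.ract r p) = N.ract r (FGPMod.toLin t p) := t.hom.hom.map_smul (op r) p

/-- The dual `P^* = Hom_{-A}(P, A)`. -/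
abbrev FGPMod.Dual (M : FGPMod φ) : Type u := M.toMod →ₗ[Aᵐᵒᵖ] A

/-- Multiplication by a scalar of `k` is an endomorphism. -/
noncomputable def FGPMod.scalar (M : FGPMod φ) (c : k) : M ⟶ M :=
  ObjectProperty.homMk (ModuleCat.ofHom
    { toFun := fun p => op (algebraMap k R c) • p
      map_add' := smul_add _
      map_smul' := fun r p => by
        rw [RingHom.id_apply, ← mul_smul, ← mul_smul, ← op_unop r, ← MulOpposite.op_mul,
          ← MulOpposite.op_mul, Algebra.commutes] })

theorem FGPMod.scalar_apply (M : FGPMod φ) (c : k) (p : M.toMod) :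
    FGPMod.toLin (M.scalar c) p = op (algebraMap k A c) • p := by
  rw [← M.ract_map, AlgHom.commutes]; rfl

section Comatrix

variable {I : Type u} (P : I → FGPMod φ)

/-- The group `P_i^* ⊗ P_i`. -/
def ComatrixCell (i : I) : Type u := (P i).Dual ⊗[ℤ] (P i).toMod

noncomputable instance (i : I) : AddCommGroup (ComatrixCell P i) :=
  inferInstanceAs (AddCommGroup ((P i).Dual ⊗[ℤ] (P i).toMod))

open scoped Classical in
/-- The element `q ⊗ p` of the summand `P_i^* ⊗ P_i` of `⨁ i, P_i^* ⊗ P_i`. -/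
noncomputable def comatrixOf (i : I) (q : (P i).Dual) (p : (P i).toMod) : ⨁ i, ComatrixCell P i :=
  DirectSum.of (ComatrixCell P) i (q ⊗ₜ[ℤ] p)

/-- The relations `q^* ⊗ t p = q^* t ⊗ p` for `t : P_i ⟶ P_j` in `𝒜_R`. -/
noncomputable def comatrixRel : Submodule ℤ (⨁ i, ComatrixCell P i) :=
  Submodule.span ℤ {x | ∃ (i j : I) (t : P i ⟶ P j) (q : (P j).Dual) (p : (P i).toMod),
    x = comatrixOf P j q (FGPMod.toLin t p) - comatrixOf P i (q ∘ₗ FGPMod.toLin t) p}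

/-- The underlying group of the infinite comatrix coring of the objects `P_i` of `𝒜_R`: the
quotient of `⨁ i, P_i^* ⊗_{T_i} P_i`, where `T_i = End(P_i)`, by `q^* ⊗ t p - q^* t ⊗ p` for all
`t : P_i ⟶ P_j`. The balancing over `T_i` is the case `i = j` of these relations, and the subgroup
that they generate is a sub-bimodule. -/
def Comatrix : Type u := (⨁ i, ComatrixCell P i) ⧸ comatrixRel P

namespace Comatrix

noncomputable instance : AddCommGroup (Comatrix P) :=
  inferInstanceAs (AddCommGroup ((⨁ i, ComatrixCell P i) ⧸ comatrixRel P))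

/-- The class of `q ⊗ p`, for `q : P_i^*` and `p : P_i`. -/
noncomputable def mk (i : I) (q : (P i).Dual) (p : (P i).toMod) : Comatrix P :=
  (comatrixRel P).mkQ (comatrixOf P i q p)

theorem mk_add (i : I) (q : (P i).Dual) (p p' : (P i).toMod) :
    mk P i q (p + p') = mk P i q p + mk P i q p' := by
  refine (congrArg (comatrixRel P).mkQ (?_ : comatrixOf P i q (p + p') =
    comatrixOf P i q p + comatrixOf P i q p')).trans (map_add _ _ _)
  classical
  exact (congrArg (DirectSum.of (ComatrixCell P) i) (TensorProduct.tmul_add q p p')).trans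
    (map_add (DirectSum.of (ComatrixCell P) i) (q ⊗ₜ[ℤ] p) (q ⊗ₜ[ℤ] p'))

theorem add_mk (i : I) (q q' : (P i).Dual) (p : (P i).toMod) :
    mk P i (q + q') p = mk P i q p + mk P i q' p := by
  refine (congrArg (comatrixRel P).mkQ (?_ : comatrixOf P i (q + q') p =
    comatrixOf P i q p + comatrixOf P i q' p)).trans (map_add _ _ _)
  classical
  exact (congrArg (DirectSum.of (ComatrixCell P) i) (TensorProduct.add_tmul q q' p)).trans
    (map_add (DirectSum.of (ComatrixCell P) i) (q ⊗ₜ[ℤ] p) (q' ⊗ₜ[ℤ] p))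

theorem mk_comp {i j : I} (t : P i ⟶ P j) (q : (P j).Dual) (p : (P i).toMod) :
    mk P j q (FGPMod.toLin t p) = mk P i (q ∘ₗ FGPMod.toLin t) p :=
  (Submodule.Quotient.eq _).2 (Submodule.subset_span ⟨i, j, t, q, p, rfl⟩)

theorem mk_sum {ι : Type*} (s : Finset ι) (i : I) (q : (P i).Dual) (p : ι → (P i).toMod) :
    mk P i q (∑ j ∈ s, p j) = ∑ j ∈ s, mk P i q (p j) :=
  map_sum (AddMonoidHom.mk' (mk P i q) (mk_add P i q)) p s

theorem sum_mk {ι : Type*} (s : Finset ι) (i : I) (q : ι → (P i).Dual) (p : (P i).toMod) :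
    mk P i (∑ j ∈ s, q j) p = ∑ j ∈ s, mk P i (q j) p :=
  map_sum (AddMonoidHom.mk' (fun q => mk P i q p) (fun q q' => add_mk P i q q' p)) q s

variable {X : Type*} [AddCommGroup X]

/-- The map out of `P_i^* ⊗ P_i` given by a biadditive map. -/
noncomputable def cellLift (i : I) (f : (P i).Dual → (P i).toMod → X)
    (hl : ∀ q q' p, f (q + q') p = f q p + f q' p)
    (hr : ∀ q p p', f q (p + p') = f q p + f q p') : ComatrixCell P i →+ X :=
  TensorProduct.liftAddHom
    (AddMonoidHom.mk' (fun q => AddMonoidHom.mk' (f q) (hr q))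
      (fun q q' => AddMonoidHom.ext (hl q q')))
    (fun r q p => by
      have h1 := map_zsmul (AddMonoidHom.mk' (f q) (hr q)) r p
      have h2 := map_zsmul (AddMonoidHom.mk' (fun q => f q p) (fun q q' => hl q q' p)) r q
      exact h2.trans h1.symm)

open scoped Classical in
/-- The map out of `⨁ i, P_i^* ⊗ P_i` given by biadditive maps. -/
noncomputable def preLift (f : ∀ i, (P i).Dual → (P i).toMod → X)
    (hl : ∀ i q q' p, f i (q + q') p = f i q p + f i q' p)
    (hr : ∀ i q p p', f i q (p + p') = f i q p + f i q p') : (⨁ i, ComatrixCell P i) →+ X :=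
  DirectSum.toAddMonoid (fun i => cellLift P i (f i) (hl i) (hr i))

theorem preLift_of (f : ∀ i, (P i).Dual → (P i).toMod → X) (hl) (hr) (i : I) (q : (P i).Dual)
    (p : (P i).toMod) : preLift P f hl hr (comatrixOf P i q p) = f i q p := by
  classical
  exact DirectSum.toAddMonoid_of (fun i => cellLift P i (f i) (hl i) (hr i)) i _

/-- The universal property of `Comatrix P`. -/
noncomputable def lift (f : ∀ i, (P i).Dual → (P i).toMod → X)
    (hl : ∀ i q q' p, f i (q + q') p = f i q p + f i q' p)
    (hr : ∀ i q p p', f i q (p + p') = f i q p + f i q p')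
    (hb : ∀ i j (t : P i ⟶ P j) q p, f j q (FGPMod.toLin t p) = f i (q ∘ₗ FGPMod.toLin t) p) :
    Comatrix P →+ X :=
  ((comatrixRel P).liftQ (preLift P f hl hr).toIntLinearMap
    (by
      refine Submodule.span_le.2 ?_
      rintro _ ⟨i, j, t, q, p, rfl⟩
      rw [SetLike.mem_coe, LinearMap.mem_ker, AddMonoidHom.coe_toIntLinearMap, map_sub, preLift_of,
        preLift_of, sub_eq_zero]
      exact hb i j t q p)).toAddMonoidHom

@[simp]
theorem lift_mk (f : ∀ i, (P i).Dual → (P i).toMod → X) (hl) (hr) (hb) (i : I) (q : (P i).Dual)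
    (p : (P i).toMod) : lift P f hl hr hb (mk P i q p) = f i q p :=
  preLift_of P f hl hr i q p

variable {P}

theorem hom_ext {f g : Comatrix P →+ X} (h : ∀ i q p, f (mk P i q p) = g (mk P i q p)) : f = g := by
  classical
  have : f.comp (comatrixRel P).mkQ.toAddMonoidHom = g.comp (comatrixRel P).mkQ.toAddMonoidHom :=
    DirectSum.addHom_ext' fun i => AddMonoidHom.ext fun x => by
      refine TensorProduct.induction_on (M := (P i).Dual) (N := (P i).toMod) (R := ℤ)
        (motive := fun x => f ((comatrixRel P).mkQ (DirectSum.of (ComatrixCell P) i x)) =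
          g ((comatrixRel P).mkQ (DirectSum.of (ComatrixCell P) i x))) x ?_ (h i) ?_
      · exact (map_zero (f.comp ((comatrixRel P).mkQ.toAddMonoidHom.comp
          (DirectSum.of (ComatrixCell P) i)))).trans (map_zero (g.comp
          ((comatrixRel P).mkQ.toAddMonoidHom.comp (DirectSum.of (ComatrixCell P) i)))).symm
      · intro x y hx hy
        exact (map_add (f.comp ((comatrixRel P).mkQ.toAddMonoidHom.comp
          (DirectSum.of (ComatrixCell P) i))) x y).trans ((congrArg₂ (· + ·) hx hy).trans
          (map_add (g.comp ((comatrixRel P).mkQ.toAddMonoidHom.comp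
            (DirectSum.of (ComatrixCell P) i))) x y).symm)
  ext x
  obtain ⟨x, rfl⟩ := (comatrixRel P).mkQ_surjective x
  exact DFunLike.congr_fun this x

theorem hom_congr {f g : Comatrix P →+ X} (h : ∀ i q p, f (mk P i q p) = g (mk P i q p))
    (x : Comatrix P) : f x = g x := DFunLike.congr_fun (hom_ext h) x

/-- `a (q ⊗ p) = a q ⊗ p`. -/
noncomputable def lsmulHom (a : A) : Comatrix P →+ Comatrix P :=
  lift P (fun i q p => mk P i (a • q) p) (fun i q q' p => by rw [smul_add, add_mk])
    (fun i q p p' => mk_add P i _ p p') (fun i j t q p => mk_comp P t (a • q) p)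

/-- `(q ⊗ p) a = q ⊗ p a`. -/
noncomputable def rsmulHom (a : Aᵐᵒᵖ) : Comatrix P →+ Comatrix P :=
  lift P (fun i q p => mk P i q (a • p)) (fun i q q' p => add_mk P i q q' _)
    (fun i q p p' => by rw [smul_add, mk_add])
    (fun i j t q p => by rw [← map_smul, mk_comp])

noncomputable instance : Module A (Comatrix P) where
  smul a x := lsmulHom a x
  one_smul := hom_congr (f := lsmulHom 1) (g := .id _) fun i q p => by
    simp [lsmulHom]
  mul_smul a b := hom_congr (f := lsmulHom (a * b)) (g := (lsmulHom a).comp (lsmulHom b))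
    fun i q p => by simp [lsmulHom, mul_smul]
  smul_zero a := map_zero (lsmulHom a)
  smul_add a := map_add (lsmulHom a)
  add_smul a b := hom_congr (f := lsmulHom (a + b)) (g := lsmulHom a + lsmulHom b)
    fun i q p => by simp [lsmulHom, add_smul, add_mk]
  zero_smul := hom_congr (f := lsmulHom 0) (g := 0) fun i q p => by
    have := map_zero (AddMonoidHom.mk' (fun q => mk P i q p) (fun q q' => add_mk P i q q' p))
    simpa [lsmulHom] using this

noncomputable instance : Module Aᵐᵒᵖ (Comatrix P) where
  smul a x := rsmulHom a x
  one_smul := hom_congr (f := rsmulHom 1) (g := .id _) fun i q p => by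
    simp [rsmulHom]
  mul_smul a b := hom_congr (f := rsmulHom (a * b)) (g := (rsmulHom a).comp (rsmulHom b))
    fun i q p => by simp only [rsmulHom, mul_smul, lift_mk, AddMonoidHom.comp_apply]
  smul_zero a := map_zero (rsmulHom a)
  smul_add a := map_add (rsmulHom a)
  add_smul a b := hom_congr (f := rsmulHom (a + b)) (g := rsmulHom a + rsmulHom b)
    fun i q p => by simp only [rsmulHom, add_smul, mk_add, lift_mk, AddMonoidHom.add_apply]
  zero_smul := hom_congr (f := rsmulHom 0) (g := 0) fun i q p => by
    have := map_zero (AddMonoidHom.mk' (mk P i q) (mk_add P i q))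
    simpa [rsmulHom] using this

theorem lsmul_mk (a : A) (i : I) (q : (P i).Dual) (p : (P i).toMod) :
    a • mk P i q p = mk P i (a • q) p := lift_mk P _ _ _ _ i q p

theorem rsmul_mk (a : Aᵐᵒᵖ) (i : I) (q : (P i).Dual) (p : (P i).toMod) :
    a • mk P i q p = mk P i q (a • p) := lift_mk P _ _ _ _ i q p

instance : SMulCommClass A Aᵐᵒᵖ (Comatrix P) where
  smul_comm a b := hom_congr (f := (lsmulHom a).comp (rsmulHom b))
    (g := (rsmulHom b).comp (lsmulHom a)) fun i q p => by
      simp only [AddMonoidHom.comp_apply, lsmulHom, rsmulHom, lift_mk]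

/-- `p ↦ q ⊗ p`, as a right linear map. -/
noncomputable def mkRight (i : I) (q : (P i).Dual) : (P i).toMod →ₗ[Aᵐᵒᵖ] Comatrix P where
  toFun p := mk P i q p
  map_add' := mk_add P i q
  map_smul' a p := (rsmul_mk a i q p).symm

/-- `q ↦ q ⊗ p`, as a left linear map. -/
noncomputable def mkLeft (i : I) (p : (P i).toMod) : (P i).Dual →ₗ[A] Comatrix P where
  toFun q := mk P i q p
  map_add' q q' := add_mk P i q q' p
  map_smul' a q := (lsmul_mk a i q p).symm

end Comatrix

/-- A chosen dual basis of the module underlying an object of `𝒜_R`. -/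
noncomputable def FGPMod.dualBasis (M : FGPMod φ) : DualBasis M.toMod :=
  (exists_dualBasis M.toMod M.property).some

/-- `∑ f(e_j) e_j^* = f`. -/
theorem DualBasis.sum_smul {V : ModuleCat.{u} Aᵐᵒᵖ} (b : DualBasis V) (f : V →ₗ[Aᵐᵒᵖ] A) :
    ∑ j, f (b.e j) • b.e' j = f := by
  ext x
  conv_rhs => rw [← b.sum_eq x, map_sum]
  rw [LinearMap.sum_apply]
  exact Finset.sum_congr rfl fun j _ => (f.map_smul _ _).symm

/-- Naturality and independence of the choice of a dual basis. -/
theorem DualBasis.naturality {V W : ModuleCat.{u} Aᵐᵒᵖ} (b : DualBasis V) (c : DualBasis W)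
    (t : V →ₗ[Aᵐᵒᵖ] W) {X : Type*} [AddCommGroup X] [Module A X]
    (g : (V →ₗ[Aᵐᵒᵖ] A) →ₗ[A] X) :
    ∑ j, BTensor.tmul A (t (b.e j)) (g (b.e' j)) =
      ∑ l, BTensor.tmul A (c.e l) (g (c.e' l ∘ₗ t)) := by
  have h1 : ∀ j, BTensor.tmul A (t (b.e j)) (g (b.e' j)) =
      ∑ l, BTensor.tmul A (c.e l) (g ((c.e' l ∘ₗ t) (b.e j) • b.e' j)) := fun j => by
    conv_lhs => rw [← c.sum_eq (t (b.e j)), BTensor.sum_tmul]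
    refine Finset.sum_congr rfl fun l _ => ?_
    rw [BTensor.smul_tmul, map_smul]; rfl
  simp only [h1]
  rw [Finset.sum_comm]
  refine Finset.sum_congr rfl fun l _ => ?_
  rw [← BTensor.tmul_sum, ← map_sum, b.sum_smul]

namespace Comatrix

/-- `Δ(q ⊗ p) = ∑ (q ⊗ e_j) ⊗_A (e_j^* ⊗ p)` in terms of a given dual basis of `P_i`. -/
noncomputable def comulAux (i : I) (b : DualBasis (P i).toMod) (q : (P i).Dual) (p : (P i).toMod) :
    BTensor A (Comatrix P) (Comatrix P) :=
  ∑ j, BTensor.tmul A (mk P i q (b.e j)) (mk P i (b.e' j) p)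

theorem comulAux_naturality {i j : I} (t : P i ⟶ P j) (b : DualBasis (P i).toMod)
    (c : DualBasis (P j).toMod) (q : (P j).Dual) (p : (P i).toMod) :
    comulAux P j c q (FGPMod.toLin t p) = comulAux P i b (q ∘ₗ FGPMod.toLin t) p := by
  have := congrArg (BTensor.map (mkRight j q) LinearMap.id)
    (b.naturality c (FGPMod.toLin t) (mkLeft i p))
  rw [map_sum, map_sum] at this
  refine Eq.trans (Finset.sum_congr rfl fun l _ => ?_)
    (this.symm.trans (Finset.sum_congr rfl fun m _ => ?_))
  · exact congrArg (BTensor.tmul A _) (mk_comp P t _ p)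
  · exact congrArg (BTensor.tmul A · _) (mk_comp P t q _)

/-- The comultiplication of the infinite comatrix coring. -/
noncomputable def comulHom : Comatrix P →+ BTensor A (Comatrix P) (Comatrix P) :=
  lift P (fun i q p => comulAux P i (P i).dualBasis q p)
    (fun i q q' p => by
      simp only [comulAux, add_mk, BTensor.add_tmul, Finset.sum_add_distrib])
    (fun i q p p' => by
      simp only [comulAux, mk_add, BTensor.tmul_add, Finset.sum_add_distrib])
    (fun i j t q p => comulAux_naturality P t _ _ q p)

theorem comulHom_mk (i : I) (b : DualBasis (P i).toMod) (q : (P i).Dual) (p : (P i).toMod) :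
    comulHom P (mk P i q p) = comulAux P i b q p :=
  (lift_mk P _ _ _ _ i q p).trans (by
    have := comulAux_naturality P (𝟙 (P i)) b (P i).dualBasis q p
    exact this)

/-- `Δ` as a bimodule map. -/
noncomputable def comul : BimodHom A (Comatrix P) (BTensor A (Comatrix P) (Comatrix P)) where
  __ := comulHom P
  map_lsmul a := hom_congr (f := (comulHom P).comp (lsmulHom a))
    (g := (BTensor.lsmulHom a).comp (comulHom P)) fun i q p => by
      change comulHom P (a • mk P i q p) = BTensor.lsmulHom a (comulHom P (mk P i q p))
      rw [lsmul_mk, comulHom_mk P i (P i).dualBasis, comulHom_mk P i (P i).dualBasis, comulAux,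
        comulAux, map_sum]
      exact Finset.sum_congr rfl fun j _ => congrArg (BTensor.tmul A · _) (lsmul_mk a i q _).symm
  map_rsmul a := hom_congr (f := (comulHom P).comp (rsmulHom a))
    (g := (BTensor.rsmulHom a).comp (comulHom P)) fun i q p => by
      change comulHom P (a • mk P i q p) = BTensor.rsmulHom a (comulHom P (mk P i q p))
      rw [rsmul_mk, comulHom_mk P i (P i).dualBasis, comulHom_mk P i (P i).dualBasis, comulAux,
        comulAux, map_sum]
      exact Finset.sum_congr rfl fun j _ => congrArg (BTensor.tmul A _) (rsmul_mk a i _ p).symm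

/-- The counit `ε(q ⊗ p) = q(p)`. -/
noncomputable def counitHom : Comatrix P →+ A :=
  lift P (fun _ q p => q p) (fun _ _ _ _ => rfl) (fun _ q p p' => map_add q p p')
    (fun _ _ _ _ _ => rfl)

theorem counitHom_mk (i : I) (q : (P i).Dual) (p : (P i).toMod) :
    counitHom P (mk P i q p) = q p := lift_mk P _ _ _ _ i q p

/-- `ε` as a bimodule map. -/
noncomputable def counit : BimodHom A (Comatrix P) A where
  __ := counitHom P
  map_lsmul a := hom_congr (f := (counitHom P).comp (lsmulHom a))
    (g := (AddMonoidHom.mulLeft a).comp (counitHom P)) fun i q p => by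
      change counitHom P (a • mk P i q p) = a * counitHom P (mk P i q p)
      rw [lsmul_mk, counitHom_mk, counitHom_mk]; rfl
  map_rsmul a := hom_congr (f := (counitHom P).comp (rsmulHom a))
    (g := (AddMonoidHom.mulRight a.unop).comp (counitHom P)) fun i q p => by
      change counitHom P (a • mk P i q p) = counitHom P (mk P i q p) * a.unop
      rw [rsmul_mk, counitHom_mk, counitHom_mk, map_smul]; rfl

/-- The infinite comatrix `A`-coring of the objects `P_i` of `𝒜_R`. -/
noncomputable def coring : Coring k A where
  carrier := Comatrix P
  central r := hom_congr (f := lsmulHom (algebraMap k A r)) (g := rsmulHom (op (algebraMap k A r)))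
    fun i q p => by
      change algebraMap k A r • mk P i q p = op (algebraMap k A r) • mk P i q p
      rw [lsmul_mk, rsmul_mk, ← FGPMod.scalar_apply, mk_comp]
      congr 1
      ext x
      rw [LinearMap.comp_apply, FGPMod.scalar_apply, map_smul, LinearMap.smul_apply, smul_eq_mul,
        op_smul_eq_mul, mul_comm]
  comul := comul P
  counit := counit P
  coassoc := hom_congr (f := (BTensor.map (comul P).right LinearMap.id).comp (comulHom P))
    (g := (BTensor.assoc A _ _ _).comp
      ((BTensor.map LinearMap.id (comul P).left).comp (comulHom P))) fun i q p => by
      have h : ∀ q p, comulHom P (mk P i q p) = comulAux P i (P i).dualBasis q p :=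
        comulHom_mk P i _
      simp only [AddMonoidHom.comp_apply, h]
      unfold comulAux
      simp only [map_sum]
      have h1 : ∀ j, BTensor.map (comul P).right (LinearMap.id : Comatrix P →ₗ[A] Comatrix P)
          (BTensor.tmul A (mk P i q ((P i).dualBasis.e j)) (mk P i ((P i).dualBasis.e' j) p)) =
          ∑ l, BTensor.tmul A (BTensor.tmul A (mk P i q ((P i).dualBasis.e l))
            (mk P i ((P i).dualBasis.e' l) ((P i).dualBasis.e j)))
            (mk P i ((P i).dualBasis.e' j) p) := fun j => by
        change BTensor.tmul A (comulHom P _) _ = _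
        rw [h, comulAux, BTensor.sum_tmul]
        rfl
      have h2 : ∀ j, BTensor.assoc A _ _ _ (BTensor.map (LinearMap.id : Comatrix P →ₗ[Aᵐᵒᵖ] _)
          (comul P).left
          (BTensor.tmul A (mk P i q ((P i).dualBasis.e j)) (mk P i ((P i).dualBasis.e' j) p))) =
          ∑ l, BTensor.tmul A (BTensor.tmul A (mk P i q ((P i).dualBasis.e j))
            (mk P i ((P i).dualBasis.e' j) ((P i).dualBasis.e l)))
            (mk P i ((P i).dualBasis.e' l) p) := fun j => by
        change BTensor.assoc A _ _ _ (BTensor.tmul A _ (comulHom P _)) = _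
        rw [h, comulAux, BTensor.tmul_sum, map_sum]
        rfl
      simp only [h1, h2]
      exact Finset.sum_comm
  counit_left := hom_congr (f := (BTensor.lid A _).comp
    ((BTensor.map (counit P).right LinearMap.id).comp (comulHom P))) (g := .id _) fun i q p => by
      simp only [AddMonoidHom.comp_apply, comulHom_mk P i (P i).dualBasis]
      unfold comulAux
      simp only [map_sum]
      have h1 : ∀ j, BTensor.lid A _ (BTensor.map (counit P).right
          (LinearMap.id : Comatrix P →ₗ[A] Comatrix P)
          (BTensor.tmul A (mk P i q ((P i).dualBasis.e j)) (mk P i ((P i).dualBasis.e' j) p))) =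
          mk P i (q ((P i).dualBasis.e j) • (P i).dualBasis.e' j) p := fun j => by
        change counitHom P (mk P i q _) • mk P i _ p = _
        rw [counitHom_mk, lsmul_mk]
      simp only [h1]
      rw [← sum_mk, DualBasis.sum_smul]
      rfl
  counit_right := hom_congr (f := (BTensor.rid A _).comp
    ((BTensor.map LinearMap.id (counit P).left).comp (comulHom P))) (g := .id _) fun i q p => by
      simp only [AddMonoidHom.comp_apply, comulHom_mk P i (P i).dualBasis]
      unfold comulAux
      simp only [map_sum]
      have h1 : ∀ j, BTensor.rid A _ (BTensor.map (LinearMap.id : Comatrix P →ₗ[Aᵐᵒᵖ] _)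
          (counit P).left
          (BTensor.tmul A (mk P i q ((P i).dualBasis.e j)) (mk P i ((P i).dualBasis.e' j) p))) =
          mk P i q (op ((P i).dualBasis.e' j p) • (P i).dualBasis.e j) := fun j => by
        change op (counitHom P (mk P i _ p)) • mk P i q _ = _
        rw [counitHom_mk, rsmul_mk]
      simp only [h1]
      rw [← mk_sum, DualBasis.sum_eq]
      rfl

/-- `ζ(q ⊗ p) : r ↦ q(p r)`. -/
noncomputable def zetaHom : Comatrix P →+ RDual φ :=
  lift P (fun i q p => ⟨AddMonoidHom.mk' (fun r => q ((P i).ract r p))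
      (fun r s => by rw [FGPMod.ract_add, map_add]), fun r a => by
        change q ((P i).ract (r * φ a) p) = q ((P i).ract r p) * a
        rw [FGPMod.ract_mul, FGPMod.ract_map, map_smul]; rfl⟩)
    (fun i q q' p => rfl)
    (fun i q p p' => RDual.ext fun r => by
      change q ((P i).ract r (p + p')) = q ((P i).ract r p) + q ((P i).ract r p')
      rw [map_add, map_add])
    (fun i j t q p => RDual.ext fun r => by
      change q ((P j).ract r (FGPMod.toLin t p)) = q (FGPMod.toLin t ((P i).ract r p))
      rw [FGPMod.toLin_ract])

theorem zetaHom_mk (i : I) (q : (P i).Dual) (p : (P i).toMod) (r : R) :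
    zetaHom P (mk P i q p) r = q ((P i).ract r p) :=
  DFunLike.congr_fun (lift_mk P _ _ _ _ i q p) r

/-- `ζ` as a bimodule map. -/
noncomputable def zeta : BimodHom A (coring P) (RDual φ) where
  __ := zetaHom P
  map_lsmul a := hom_congr (f := (zetaHom P).comp (lsmulHom a))
    (g := (DistribSMul.toAddMonoidHom (RDual φ) a).comp (zetaHom P)) fun i q p =>
      RDual.ext fun r => by
        change zetaHom P (a • mk P i q p) r = a * zetaHom P (mk P i q p) r
        rw [lsmul_mk, zetaHom_mk, zetaHom_mk]; rfl
  map_rsmul a := hom_congr (f := (zetaHom P).comp (rsmulHom a))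
    (g := (DistribSMul.toAddMonoidHom (RDual φ) a).comp (zetaHom P)) fun i q p =>
      RDual.ext fun r => by
        change zetaHom P (a • mk P i q p) r = zetaHom P (mk P i q p) (φ a.unop * r)
        rw [rsmul_mk, zetaHom_mk, zetaHom_mk, FGPMod.ract_mul, FGPMod.ract_map]; rfl

theorem isDualPairing_zeta : IsDualPairing (zeta P) where
  map_mul c x y := hom_congr
    (f := AddMonoidHom.mk' (fun c => zetaHom P c (x * y)) (fun c d => by rw [map_add]; rfl))
    (g := (convAt (zeta P) x y).comp (comulHom P)) (fun i q p => by
      change zetaHom P (mk P i q p) (x * y) = convAt (zeta P) x y (comulHom P (mk P i q p))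
      rw [comulHom_mk P i (P i).dualBasis, comulAux, zetaHom_mk]
      refine Eq.trans ?_ (map_sum (convAt (zeta P) x y) _ _).symm
      have h : ∀ j, convAt (zeta P) x y
          (BTensor.tmul A (mk P i q ((P i).dualBasis.e j)) (mk P i ((P i).dualBasis.e' j) p)) =
          q ((P i).ract y (op ((P i).dualBasis.e' j ((P i).ract x p)) • (P i).dualBasis.e j)) :=
        fun j => by
          change zetaHom P (mk P i q _) (φ (zetaHom P (mk P i _ p) x) * y) = _
          rw [zetaHom_mk, zetaHom_mk, FGPMod.ract_mul, FGPMod.ract_map]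
      refine Eq.trans ?_ (Finset.sum_congr rfl fun j _ => h j).symm
      rw [← map_sum, ← map_sum, DualBasis.sum_eq, FGPMod.ract_mul]) c
  map_one c := hom_congr
    (f := AddMonoidHom.mk' (fun c => zetaHom P c 1) (fun c d => by rw [map_add]; rfl))
    (g := counitHom P) (fun i q p => by
      change zetaHom P (mk P i q p) 1 = counitHom P (mk P i q p)
      rw [zetaHom_mk, counitHom_mk]
      exact congrArg q (one_smul Rᵐᵒᵖ (p : (P i).obj))) c

end Comatrix
end Comatrix

variable (φ)

/-- The objects of a small category equivalent to `𝒜_R`, as objects of `𝒜_R`. -/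
noncomputable def circObj (i : SmallModel.{u} (FGPMod φ)) : FGPMod φ :=
  (equivSmallModel.{u} (FGPMod φ)).inverse.obj i

/-- The finite dual `R^∘`: the infinite comatrix coring of a small model of `𝒜_R`. -/
noncomputable def circ : Coring k A := Comatrix.coring (circObj φ)

/-- The bimodule map `ζ : R^∘ → R^*`. -/
noncomputable def circZeta : BimodHom A (circ φ) (RDual φ) := Comatrix.zeta (circObj φ)

theorem isDualPairing_circZeta : IsDualPairing (circZeta φ) :=
  Comatrix.isDualPairing_zeta (circObj φ)

variable {φ}

/-- The object of the small model isomorphic to `M`. -/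
noncomputable def FGPMod.idx (M : FGPMod φ) : SmallModel.{u} (FGPMod φ) :=
  (equivSmallModel.{u} (FGPMod φ)).functor.obj M

/-- The isomorphism of `M` with its copy in the small model. -/
noncomputable def FGPMod.toModel (M : FGPMod φ) : M ≅ circObj φ M.idx :=
  (equivSmallModel.{u} (FGPMod φ)).unitIso.app M

/-- The class in `R^∘` of `q ⊗ m`, for any `M` in `𝒜_R`, `q : M^*` and `m : M`. -/
noncomputable def circMk (M : FGPMod φ) (q : M.Dual) (m : M.toMod) : circ φ :=
  Comatrix.mk (circObj φ) M.idx (q ∘ₗ FGPMod.toLin M.toModel.inv) (FGPMod.toLin M.toModel.hom m)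

theorem FGPMod.toLin_comp {M N L : FGPMod φ} (s : M ⟶ N) (t : N ⟶ L) :
    FGPMod.toLin (s ≫ t) = FGPMod.toLin t ∘ₗ FGPMod.toLin s := rfl

theorem FGPMod.inv_hom_apply (M : FGPMod φ) (m : M.toMod) :
    FGPMod.toLin M.toModel.inv (FGPMod.toLin M.toModel.hom m) = m := by
  rw [← LinearMap.comp_apply, ← FGPMod.toLin_comp, M.toModel.hom_inv_id]; rfl

theorem FGPMod.hom_inv_apply (M : FGPMod φ) (m : (circObj φ M.idx).toMod) :
    FGPMod.toLin M.toModel.hom (FGPMod.toLin M.toModel.inv m) = m := by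
  rw [← LinearMap.comp_apply, ← FGPMod.toLin_comp, M.toModel.inv_hom_id]; rfl

theorem circMk_comp {M N : FGPMod φ} (t : M ⟶ N) (q : N.Dual) (m : M.toMod) :
    circMk N q (FGPMod.toLin t m) = circMk M (q ∘ₗ FGPMod.toLin t) m := by
  have := Comatrix.mk_comp (circObj φ) (i := M.idx) (j := N.idx)
    (M.toModel.inv ≫ t ≫ N.toModel.hom) (q ∘ₗ FGPMod.toLin N.toModel.inv)
    (FGPMod.toLin M.toModel.hom m)
  simp only [FGPMod.toLin_comp, LinearMap.comp_apply, FGPMod.inv_hom_apply] at this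
  refine this.trans (congrArg (Comatrix.mk (circObj φ) M.idx · _) (LinearMap.ext fun x => ?_))
  simp only [LinearMap.comp_apply, FGPMod.inv_hom_apply]

/-- `q ↦ [q ⊗ m]`, as a left linear map. -/
noncomputable def circMkLeft (M : FGPMod φ) (m : M.toMod) : M.Dual →ₗ[A] circ φ where
  toFun q := circMk M q m
  map_add' q q' := Comatrix.add_mk (circObj φ) M.idx (q ∘ₗ FGPMod.toLin M.toModel.inv)
    (q' ∘ₗ FGPMod.toLin M.toModel.inv) (FGPMod.toLin M.toModel.hom m)
  map_smul' a q := (Comatrix.lsmul_mk (P := circObj φ) a M.idx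
    (q ∘ₗ FGPMod.toLin M.toModel.inv) (FGPMod.toLin M.toModel.hom m)).symm

/-- `m ↦ [q ⊗ m]`, as a right linear map. -/
noncomputable def circMkRight (M : FGPMod φ) (q : M.Dual) : M.toMod →ₗ[Aᵐᵒᵖ] circ φ where
  toFun m := circMk M q m
  map_add' m m' := by
    rw [circMk, map_add]; exact Comatrix.mk_add (circObj φ) _ _ _ _
  map_smul' a m := by
    rw [circMk, map_smul]; exact (Comatrix.rsmul_mk a _ _ _).symm

theorem comul_circMk (M : FGPMod φ) (q : M.Dual) (m : M.toMod) :
    (circ φ).comul (circMk M q m) = ∑ j, BTensor.tmul A (circMk M q (M.dualBasis.e j))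
      (circMk M (M.dualBasis.e' j) m) := by
  let b : DualBasis (circObj φ M.idx).toMod :=
    { n := M.dualBasis.n
      e := fun j => FGPMod.toLin M.toModel.hom (M.dualBasis.e j)
      e' := fun j => M.dualBasis.e' j ∘ₗ FGPMod.toLin M.toModel.inv
      sum_eq := fun p => by
        conv_rhs => rw [← M.hom_inv_apply p, ← M.dualBasis.sum_eq (FGPMod.toLin M.toModel.inv p),
          map_sum]
        exact Finset.sum_congr rfl fun j _ => (map_smul _ _ _).symm }
  exact Comatrix.comulHom_mk (circObj φ) M.idx b _ _

theorem counit_circMk (M : FGPMod φ) (q : M.Dual) (m : M.toMod) :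
    (circ φ).counit (circMk M q m) = q m :=
  (Comatrix.counitHom_mk (circObj φ) M.idx _ _).trans (congrArg q (M.inv_hom_apply m))

/-- The coaction `m ↦ ∑ e_j ⊗_A [e_j^* ⊗ m]` of `R^∘` on an object of `𝒜_R`. -/
noncomputable def chiCoact (M : FGPMod φ) : M.toMod →ₗ[Aᵐᵒᵖ] BTensor A M.toMod (circ φ) where
  toFun m := ∑ j, BTensor.tmul A (M.dualBasis.e j) (circMk M (M.dualBasis.e' j) m)
  map_add' m n := by
    rw [← Finset.sum_add_distrib]
    refine Finset.sum_congr rfl fun j _ => ?_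
    rw [← BTensor.tmul_add]
    exact congrArg _ ((circMkRight M _).map_add m n)
  map_smul' a m := by
    rw [RingHom.id_apply, Finset.smul_sum]
    exact Finset.sum_congr rfl fun j _ => congrArg _ ((circMkRight M _).map_smul a m)

/-- An object of `𝒜_R`, as a right `R^∘`-comodule. -/
noncomputable def chiObj (M : FGPMod φ) : Comod (circ φ) where
  toMod := M.toMod
  coact := chiCoact M
  coassoc m := by
    change BTensor.map (chiCoact M) LinearMap.id (∑ j, BTensor.tmul A (M.dualBasis.e j)
        (circMk M (M.dualBasis.e' j) m)) = BTensor.assoc A M.toMod (circ φ) (circ φ)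
      (BTensor.map LinearMap.id (circ φ).comul.left (∑ j, BTensor.tmul A (M.dualBasis.e j)
        (circMk M (M.dualBasis.e' j) m)))
    simp only [map_sum, BTensor.map_tmul, BimodHom.left_apply, comul_circMk, BTensor.tmul_sum,
      LinearMap.id_apply, BTensor.assoc_tmul]
    rw [Finset.sum_comm]
    refine Finset.sum_congr rfl fun j _ => ?_
    rw [← BTensor.sum_tmul]
    rfl
  counit m := by
    change BTensor.rid A M.toMod (BTensor.map LinearMap.id (circ φ).counit.left
      (∑ j, BTensor.tmul A (M.dualBasis.e j) (circMk M (M.dualBasis.e' j) m))) = m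
    simp only [map_sum, BTensor.map_tmul, BimodHom.left_apply, counit_circMk, LinearMap.id_apply,
      BTensor.rid_tmul]
    exact M.dualBasis.sum_eq m

/-- An `R`-linear map is colinear. -/
noncomputable def chiHom {M N : FGPMod φ} (t : M ⟶ N) : Comod.Hom (chiObj M) (chiObj N) where
  lin := FGPMod.toLin t
  colinear m := by
    have := M.dualBasis.naturality N.dualBasis (FGPMod.toLin t) (circMkLeft M m)
    change ∑ l, BTensor.tmul A (N.dualBasis.e l)
        (circMk N (N.dualBasis.e' l) (FGPMod.toLin t m)) =
      BTensor.map (FGPMod.toLin t) LinearMap.id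
        (∑ j, BTensor.tmul A (M.dualBasis.e j) (circMk M (M.dualBasis.e' j) m))
    rw [map_sum]
    refine Eq.trans (Finset.sum_congr rfl fun l _ => ?_) this.symm
    exact congrArg _ (circMk_comp t _ m)

variable (φ) in
/-- The functor `χ : 𝒜_R ⥤ 𝒜^{R^∘}`, which keeps underlying modules and underlying maps. -/
noncomputable def chi : FGPMod φ ⥤ FGPComod (circ φ) where
  obj M := ⟨chiObj M, M.property⟩
  map t := ObjectProperty.homMk (chiHom t)

namespace SaftDual

variable (D : SaftDual φ)

/-- The coring morphism `ζ̂ : R^∘ → R^•` with `ξ ∘ ζ̂ = ζ`. -/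
noncomputable def zetaHat : CoringHom (circ φ) D.coring :=
  D.hat (circZeta φ) (isDualPairing_circZeta φ)

/-- The functor `ℒ' : 𝒜^{R^•} ⥤ 𝒜_R`, where `R` acts by `m · r = m₍₀₎ ξ(m₍₁₎)(r)`. -/
noncomputable def functorL : FGPComod D.coring ⥤ FGPMod φ := comodToModFunctor D.pairing

/-- The functor `χ' = 𝒜^{ζ̂} ∘ χ : 𝒜_R ⥤ 𝒜^{R^•}`. -/
noncomputable def functorChi : FGPMod φ ⥤ FGPComod D.coring := chi φ ⋙ FGPComod.induce D.zetaHat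

end SaftDual
end Circ
end FiniteDual

/-!
The proof has two halves.

*Existence of `R^•`.* Call a compatible map `ξ : T → R^*` separated if its kernel contains no nonzero
coideal. The image of the difference of two coring morphisms is a coideal, so a separated map is a
monomorphism for coring morphisms (`IsSeparated.hom_ext`). Dividing by the sum of all coideals in the
kernel makes any compatible map separated (`IsDualPairing.exists_separated`). Suppose that a set of
compatible maps `C_i → R^*` is given, such that every element of every coring `C` with a compatible
map `f` is in the image of some `C_i → C` over `R^*`. Then the separated quotient `T` of `⨁ C_i` is
universal: `C` is a quotient of the direct sum of the `C_i` over all morphisms `C_i → C`, this direct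
sum maps to `T` too, and the image in `T` of the kernel of the quotient map is a coideal in the kernel
of `ξ`, hence zero (`nonempty_saftDual_of_generators`).

Such a set exists because every element of a coring `C` lies in a subcoring whose cardinality is
bounded in terms of `A` (`exists_small_coring`). A sub-bimodule `E` is a subcoring as soon as `Δ` maps
it to the image of `E ⊗ E`, and `E ⊗ E → C ⊗ C` and `E ⊗ E ⊗ E → C ⊗ C ⊗ C` are injective. A relation
between pure tensors over `C` holds already over every `E` that contains suitable countably many
elements of `C`, because tensor products commute with directed unions. In place of the directed
colimits, the proof uses families indexed by all sub-bimodules `E`, modulo equality for all large `E`.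
So `E` has these properties if it is closed under countably many operations of countable arity
(`exists_closed_subBimod`), and then it is a quotient of a fixed type of terms.

*The functors.* Let `M` be a comodule over `R^•`, with dual basis `e_j, e_j^*`. Its coaction is
`m ↦ ∑ e_j ⊗ e_j^*(m₍₀₎) m₍₁₎`, and that of `χ'(ℒ'(M))` is `m ↦ ∑ e_j ⊗ ζ̂(e_j^* ⊗ m)`. The elements
`q(m₍₀₎) m₍₁₎` and `ζ̂(q ⊗ m)` of `R^•` have the same image `r ↦ q(m r)` in `R^*`, and both families
satisfy `Δ(c_{q,m}) = ∑ c_{q,e_j} ⊗ c_{e_j^*,m}`. Hence their differences span a coideal in the kernel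
of `ξ`, which vanishes since `ξ` is separated (`SaftDual.isSeparated`, `SaftDual.coeff_eq_hatMk`). In
the other direction `m · r = ∑ e_j e_j^*(m r) = m r`. Both composites thus agree with the identity on
underlying sets, and the equalities of functors follow.
-/

namespace FiniteDual

open MulOpposite
open scoped TensorProduct DirectSum

/-! ### Bimodule maps and balanced tensor products -/

section Bimodules

variable {A : Type*} [Ring A]

theorem BTensor.induction_on {M N : Type*} [AddCommGroup M] [AddCommGroup N] [Module Aᵐᵒᵖ M]
    [Module A N] {p : BTensor A M N → Prop} (x : BTensor A M N) (zero : p 0)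
    (tmul : ∀ m n, p (BTensor.tmul A m n)) (add : ∀ x y, p x → p y → p (x + y)) : p x := by
  obtain ⟨x, rfl⟩ := (balancedRel A M N).mkQ_surjective x
  induction x with
  | zero => exact zero
  | tmul m n => exact tmul m n
  | add x y hx hy => exact add _ _ hx hy

theorem BTensor.map_id {M N : Type*} [AddCommGroup M] [AddCommGroup N] [Module Aᵐᵒᵖ M]
    [Module A N] (x : BTensor A M N) :
    BTensor.map (LinearMap.id : M →ₗ[Aᵐᵒᵖ] M) (LinearMap.id : N →ₗ[A] N) x = x :=
  BTensor.hom_congr (f := BTensor.map LinearMap.id LinearMap.id) (g := .id _) (fun _ _ => rfl) x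

namespace BimodHom

variable {X Y Z : Type*} [AddCommGroup X] [AddCommGroup Y] [AddCommGroup Z] [Module A X]
  [Module Aᵐᵒᵖ X] [Module A Y] [Module Aᵐᵒᵖ Y] [Module A Z] [Module Aᵐᵒᵖ Z]

theorem ext {f g : BimodHom A X Y} (h : ∀ x, f x = g x) : f = g := by
  obtain ⟨f, _, _⟩ := f
  obtain ⟨g, _, _⟩ := g
  obtain rfl : f = g := AddMonoidHom.ext h
  rfl

theorem apply_add (f : BimodHom A X Y) (x y : X) : f (x + y) = f x + f y := f.map_add' x y

theorem apply_zero (f : BimodHom A X Y) : f 0 = 0 := f.map_zero'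

theorem apply_sub (f : BimodHom A X Y) (x y : X) : f (x - y) = f x - f y :=
  map_sub f.toAddMonoidHom x y

/-- Composition of bimodule maps. -/
def comp (g : BimodHom A Y Z) (f : BimodHom A X Y) : BimodHom A X Z where
  __ := g.toAddMonoidHom.comp f.toAddMonoidHom
  map_lsmul a x := (congrArg g (f.map_lsmul a x)).trans (g.map_lsmul a (f x))
  map_rsmul a x := (congrArg g (f.map_rsmul a x)).trans (g.map_rsmul a (f x))

@[simp]
theorem comp_apply (g : BimodHom A Y Z) (f : BimodHom A X Y) (x : X) : g.comp f x = g (f x) := rfl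

variable (A X) in
/-- The identity of a bimodule. -/
def id : BimodHom A X X where
  __ := AddMonoidHom.id X
  map_lsmul _ _ := rfl
  map_rsmul _ _ := rfl

/-- `h ⊗_A h`. -/
def sq (h : BimodHom A X Y) : BTensor A X X →+ BTensor A Y Y := BTensor.map h.right h.left

theorem sq_tmul (h : BimodHom A X Y) (x y : X) :
    h.sq (BTensor.tmul A x y) = BTensor.tmul A (h x) (h y) := rfl

theorem sq_comp (g : BimodHom A Y Z) (f : BimodHom A X Y) (t : BTensor A X X) :
    (g.comp f).sq t = g.sq (f.sq t) :=
  BTensor.hom_congr (f := (g.comp f).sq) (g := g.sq.comp f.sq) (fun _ _ => rfl) t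

theorem sq_id (t : BTensor A X X) : (BimodHom.id A X).sq t = t := BTensor.map_id t

/-- `h ⊗_A h` as a bimodule map. -/
def sqHom [SMulCommClass A Aᵐᵒᵖ X] [SMulCommClass A Aᵐᵒᵖ Y] (h : BimodHom A X Y) :
    BimodHom A (BTensor A X X) (BTensor A Y Y) where
  __ := h.sq
  map_lsmul a := (BTensor.mapLeft h h.left).map_smul a
  map_rsmul a := (BTensor.mapRight h.right h).map_smul a

/-- `(h ⊗ h) ⊗ h` and `h ⊗ (h ⊗ h)` correspond under associativity. -/
theorem assoc_sq [SMulCommClass A Aᵐᵒᵖ X] [SMulCommClass A Aᵐᵒᵖ Y] (h : BimodHom A X Y)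
    (t : BTensor A X (BTensor A X X)) :
    BTensor.map h.sqHom.right h.left (BTensor.assoc A X X X t) =
      BTensor.assoc A Y Y Y (BTensor.map h.right h.sqHom.left t) :=
  BTensor.hom_congr
    (f := (BTensor.map h.sqHom.right h.left).comp (BTensor.assoc A X X X))
    (g := (BTensor.assoc A Y Y Y).comp (BTensor.map h.right h.sqHom.left))
    (fun x => BTensor.hom_congr
      (f := (BTensor.map h.sqHom.right h.left).comp (BTensor.assocAux x))
      (g := (BTensor.assocAux (h x)).comp h.sq) fun _ _ => rfl) t

/-- A bimodule map that vanishes on the kernel of a surjective bimodule map factors through it. -/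
theorem exists_factor (p : BimodHom A X Y) (hp : Function.Surjective p) (h : BimodHom A X Z)
    (hk : ∀ x, p x = 0 → h x = 0) : ∃ g : BimodHom A Y Z, g.comp p = h := by
  have key : ∀ x y, p x = p y → h x = h y := fun x y e => by
    rw [← sub_eq_zero, ← apply_sub]
    exact hk _ (by rw [apply_sub, e, sub_self])
  choose s hs using hp
  have hc : ∀ x, h (s (p x)) = h x := fun x => key _ _ (hs _)
  refine ⟨⟨AddMonoidHom.mk' (fun y => h (s y)) fun y y' => ?_, fun a y => ?_, fun a y => ?_⟩,
    ext hc⟩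
  · rw [← apply_add]
    exact key _ _ (by rw [apply_add, hs, hs, hs])
  · change h (s (a • y)) = a • h (s y)
    rw [← h.map_lsmul]
    exact key _ _ (by rw [p.map_lsmul, hs, hs])
  · change h (s (a • y)) = a • h (s y)
    rw [← h.map_rsmul]
    exact key _ _ (by rw [p.map_rsmul, hs, hs])

end BimodHom

variable (A) in
/-- Sub-bimodules. -/
structure SubBimod (X : Type*) [AddCommGroup X] [Module A X] [Module Aᵐᵒᵖ X] extends
    Submodule A X where
  rsmul_mem' : ∀ (a : Aᵐᵒᵖ) {x : X}, x ∈ carrier → a • x ∈ carrier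

namespace SubBimod

variable {X : Type*} [AddCommGroup X] [Module A X] [Module Aᵐᵒᵖ X] (N : SubBimod A X)

instance : SMul Aᵐᵒᵖ N.toSubmodule := ⟨fun a x => ⟨a • x.1, N.rsmul_mem' a x.2⟩⟩

instance : Module Aᵐᵒᵖ N.toSubmodule :=
  Function.Injective.module Aᵐᵒᵖ N.toSubmodule.subtype.toAddMonoidHom Subtype.val_injective
    fun _ _ => rfl

instance [SMulCommClass A Aᵐᵒᵖ X] : SMulCommClass A Aᵐᵒᵖ N.toSubmodule :=
  ⟨fun a b x => Subtype.ext (smul_comm a b x.1)⟩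

/-- The inclusion of a sub-bimodule. -/
def incl : BimodHom A N.toSubmodule X where
  __ := N.toSubmodule.subtype.toAddMonoidHom
  map_lsmul _ _ := rfl
  map_rsmul _ _ := rfl

theorem incl_injective : Function.Injective N.incl := Subtype.val_injective

instance : SMul Aᵐᵒᵖ (X ⧸ N.toSubmodule) :=
  ⟨fun a => QuotientAddGroup.map _ _ (DistribSMul.toAddMonoidHom X a)
    fun _ hx => N.rsmul_mem' a hx⟩

instance : Module Aᵐᵒᵖ (X ⧸ N.toSubmodule) :=
  Function.Surjective.module Aᵐᵒᵖ N.toSubmodule.mkQ.toAddMonoidHom N.toSubmodule.mkQ_surjective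
    fun _ _ => rfl

instance [SMulCommClass A Aᵐᵒᵖ X] : SMulCommClass A Aᵐᵒᵖ (X ⧸ N.toSubmodule) :=
  ⟨fun a b x => by
    obtain ⟨x, rfl⟩ := N.toSubmodule.mkQ_surjective x
    exact congrArg N.toSubmodule.mkQ (smul_comm a b x)⟩

/-- The projection to the quotient bimodule. -/
def proj : BimodHom A X (X ⧸ N.toSubmodule) where
  __ := N.toSubmodule.mkQ.toAddMonoidHom
  map_lsmul _ _ := rfl
  map_rsmul _ _ := rfl

theorem proj_surjective : Function.Surjective N.proj := N.toSubmodule.mkQ_surjective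

theorem proj_eq_zero {x : X} : N.proj x = 0 ↔ x ∈ N.toSubmodule := Submodule.Quotient.mk_eq_zero _

variable {Y : Type*} [AddCommGroup Y] [Module A Y] [Module Aᵐᵒᵖ Y]

/-- The image of a sub-bimodule. -/
def map (f : BimodHom A X Y) : SubBimod A Y where
  __ := N.toSubmodule.map f.left
  rsmul_mem' := by
    rintro a _ ⟨x, hx, rfl⟩
    exact ⟨a • x, N.rsmul_mem' a hx, f.map_rsmul a x⟩

/-- The preimage of a sub-bimodule. -/
def comap (f : BimodHom A Y X) : SubBimod A Y where
  __ := N.toSubmodule.comap f.left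
  rsmul_mem' a y hy := by
    change f (a • y) ∈ N.toSubmodule
    rw [f.map_rsmul]
    exact N.rsmul_mem' a hy

/-- The kernel of a bimodule map. -/
def ker (f : BimodHom A X Y) : SubBimod A X where
  __ := LinearMap.ker f.left
  rsmul_mem' a x hx := by
    change f (a • x) = 0
    rw [f.map_rsmul, show f x = 0 from hx, smul_zero]

/-- The image of the difference of two bimodule maps. -/
def rangeSub (f g : BimodHom A X Y) : SubBimod A Y where
  __ := LinearMap.range (f.left - g.left)
  rsmul_mem' := by
    rintro a _ ⟨x, rfl⟩
    refine ⟨a • x, ?_⟩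
    change f (a • x) - g (a • x) = a • (f x - g x)
    rw [f.map_rsmul, g.map_rsmul, smul_sub]

/-- The sub-bimodule generated by a subset that is stable under both actions. -/
def closure (s : Set X) (hl : ∀ (a : A), ∀ x ∈ s, a • x ∈ s)
    (hr : ∀ (a : Aᵐᵒᵖ), ∀ x ∈ s, a • x ∈ s) : SubBimod A X where
  __ := AddSubgroup.closure s
  smul_mem' a x hx := by
    change a • x ∈ AddSubgroup.closure s
    induction hx using AddSubgroup.closure_induction with
    | mem x hx => exact AddSubgroup.subset_closure (hl a x hx)
    | zero => rw [smul_zero]; exact zero_mem _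
    | add x y _ _ hx hy => rw [smul_add]; exact add_mem hx hy
    | neg x _ hx => rw [smul_neg]; exact neg_mem hx
  rsmul_mem' a x hx := by
    change a • x ∈ AddSubgroup.closure s
    induction hx using AddSubgroup.closure_induction with
    | mem x hx => exact AddSubgroup.subset_closure (hr a x hx)
    | zero => rw [smul_zero]; exact zero_mem _
    | add x y _ _ hx hy => rw [smul_add]; exact add_mem hx hy
    | neg x _ hx => rw [smul_neg]; exact neg_mem hx

end SubBimod
end Bimodules

/-! ### Corings covered by corings -/

section Cover

variable {k A R : Type u} [Field k] [CommRing A] [Algebra k A] [Ring R] [Algebra k R]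

namespace CoringHom

variable {C D E : Coring k A}

theorem ext {f g : CoringHom C D} (h : ∀ x, f x = g x) : f = g := by
  obtain ⟨f, _, _⟩ := f
  obtain ⟨g, _, _⟩ := g
  obtain rfl : f = g := BimodHom.ext h
  rfl

theorem comul_apply (f : CoringHom C D) (c : C) : D.comul (f c) = f.sq (C.comul c) := f.map_comul c

/-- Composition of coring morphisms. -/
def comp (g : CoringHom D E) (f : CoringHom C D) : CoringHom C E where
  __ := g.toBimodHom.comp f.toBimodHom
  map_comul c := (g.map_comul (f c)).trans
    ((congrArg g.sq (f.map_comul c)).trans (BimodHom.sq_comp _ _ _).symm)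
  map_counit c := (g.map_counit (f c)).trans (f.map_counit c)

variable (C) in
/-- The identity of a coring. -/
def id : CoringHom C C where
  __ := BimodHom.id A C
  map_comul _ := (BimodHom.sq_id _).symm
  map_counit _ := rfl

end CoringHom

theorem convAt_sq {φ : A →ₐ[k] R} {C D : Coring k A} (g : BimodHom A C D)
    (f : BimodHom A D (RDual φ)) (x y : R) (t : BTensor A C C) :
    convAt f x y (g.sq t) = convAt (f.comp g) x y t :=
  BTensor.hom_congr (f := (convAt f x y).comp g.sq) (g := convAt (f.comp g) x y)
    (fun _ _ => rfl) t

section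

variable {ι : Type*} (C : ι → Coring k A) {Q : Type u} [AddCommGroup Q] [Module A Q]
  [Module Aᵐᵒᵖ Q] (p : ∀ i, BimodHom A (C i) Q)

/-- A family of bimodule maps is spanning if the images generate the target as a group. -/
def IsSpanning : Prop := ∀ S : AddSubgroup Q, (∀ i c, p i c ∈ S) → S = ⊤

variable {C p}

theorem IsSpanning.hom_congr (hp : IsSpanning C p) {V : Type*} [AddCommGroup V] {f g : Q →+ V}
    (h : ∀ i c, f (p i c) = g (p i c)) (x : Q) : f x = g x := by
  have := hp (f.eqLocus g) h
  exact (this ▸ AddSubgroup.mem_top x : x ∈ f.eqLocus g)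

theorem isSpanning_of_surjective {C : Coring k A} {p : BimodHom A C Q}
    (hp : Function.Surjective p) : IsSpanning (fun _ : Unit => C) (fun _ => p) := fun S hS => by
  refine (AddSubgroup.eq_top_iff' S).2 fun x => ?_
  obtain ⟨c, rfl⟩ := hp x
  exact hS () c

/-- An additive map out of a spanned bimodule is bilinear if its restrictions are. -/
def IsSpanning.bimodHom (hp : IsSpanning C p) {V : Type*} [AddCommGroup V] [Module A V]
    [Module Aᵐᵒᵖ V] (f : Q →+ V) (g : ∀ i, BimodHom A (C i) V) (h : ∀ i c, f (p i c) = g i c) :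
    BimodHom A Q V where
  __ := f
  map_lsmul a := hp.hom_congr (f := f.comp (DistribSMul.toAddMonoidHom Q a))
    (g := (DistribSMul.toAddMonoidHom V a).comp f) fun i c => by
      change f (a • p i c) = a • f (p i c)
      rw [← (p i).map_lsmul, h, h, (g i).map_lsmul]
  map_rsmul a := hp.hom_congr (f := f.comp (DistribSMul.toAddMonoidHom Q a))
    (g := (DistribSMul.toAddMonoidHom V a).comp f) fun i c => by
      change f (a • p i c) = a • f (p i c)
      rw [← (p i).map_rsmul, h, h, (g i).map_rsmul]

/-- A bimodule spanned by images of corings is a coring as soon as their comultiplications and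
counits induce maps on it. -/
@[reducible]
def Coring.ofSpanning [SMulCommClass A Aᵐᵒᵖ Q] (hp : IsSpanning C p) (Δ : BimodHom A Q (BTensor A Q Q)) 
    (ε : BimodHom A Q A) (hΔ : ∀ i c, Δ (p i c) = (p i).sq ((C i).comul c))
    (hε : ∀ i c, ε (p i c) = (C i).counit c) : Coring k A where
  carrier := Q
  central r := hp.hom_congr (f := DistribSMul.toAddMonoidHom Q (algebraMap k A r))
    (g := DistribSMul.toAddMonoidHom Q (op (algebraMap k A r))) fun i c => by
      change algebraMap k A r • p i c = op (algebraMap k A r) • p i c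
      rw [← (p i).map_lsmul, ← (p i).map_rsmul, (C i).central]
  comul := Δ
  counit := ε
  coassoc := hp.hom_congr (f := (BTensor.map Δ.right LinearMap.id).comp Δ.toAddMonoidHom)
    (g := (BTensor.assoc A Q Q Q).comp ((BTensor.map LinearMap.id Δ.left).comp Δ.toAddMonoidHom))
    fun i c => by
      change BTensor.map Δ.right LinearMap.id (Δ (p i c)) =
        BTensor.assoc A Q Q Q (BTensor.map LinearMap.id Δ.left (Δ (p i c)))
      have h1 : BTensor.map Δ.right LinearMap.id ((p i).sq ((C i).comul c)) =
          BTensor.map (p i).sqHom.right (p i).left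
            (BTensor.map (C i).comul.right LinearMap.id ((C i).comul c)) :=
        BTensor.hom_congr (f := (BTensor.map Δ.right LinearMap.id).comp (p i).sq)
          (g := (BTensor.map (p i).sqHom.right (p i).left).comp
            (BTensor.map (C i).comul.right LinearMap.id))
          (fun x y => congrArg (BTensor.tmul A · (p i y)) (hΔ i x)) _
      have h2 : BTensor.map LinearMap.id Δ.left ((p i).sq ((C i).comul c)) =
          BTensor.map (p i).right (p i).sqHom.left
            (BTensor.map LinearMap.id (C i).comul.left ((C i).comul c)) :=
        BTensor.hom_congr (f := (BTensor.map LinearMap.id Δ.left).comp (p i).sq)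
          (g := (BTensor.map (p i).right (p i).sqHom.left).comp
            (BTensor.map LinearMap.id (C i).comul.left))
          (fun x y => congrArg (BTensor.tmul A (p i x)) (hΔ i y)) _
      rw [hΔ, h1, h2, (C i).coassoc, BimodHom.assoc_sq]
  counit_left := hp.hom_congr (f := (BTensor.lid A Q).comp
    ((BTensor.map ε.right LinearMap.id).comp Δ.toAddMonoidHom)) (g := .id _) fun i c => by
      change BTensor.lid A Q (BTensor.map ε.right LinearMap.id (Δ (p i c))) = p i c
      conv_rhs => rw [← (C i).counit_left c]
      rw [hΔ]
      exact BTensor.hom_congr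
        (f := (BTensor.lid A Q).comp ((BTensor.map ε.right LinearMap.id).comp (p i).sq))
        (g := (p i).toAddMonoidHom.comp ((BTensor.lid A (C i)).comp
          (BTensor.map (C i).counit.right LinearMap.id)))
        (fun x y => (congrArg (· • p i y) (hε i x)).trans ((p i).map_lsmul _ y).symm) _
  counit_right := hp.hom_congr (f := (BTensor.rid A Q).comp
    ((BTensor.map LinearMap.id ε.left).comp Δ.toAddMonoidHom)) (g := .id _) fun i c => by
      change BTensor.rid A Q (BTensor.map LinearMap.id ε.left (Δ (p i c))) = p i c
      conv_rhs => rw [← (C i).counit_right c]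
      rw [hΔ]
      exact BTensor.hom_congr
        (f := (BTensor.rid A Q).comp ((BTensor.map LinearMap.id ε.left).comp (p i).sq))
        (g := (p i).toAddMonoidHom.comp ((BTensor.rid A (C i)).comp
          (BTensor.map LinearMap.id (C i).counit.left)))
        (fun x y => (congrArg (fun a => op a • p i x) (hε i y)).trans
          ((p i).map_rsmul _ x).symm) _

end

/-- A bimodule map out of a coring spanned by images of corings is compatible if its restrictions
are. -/
theorem IsSpanning.isDualPairing {φ : A →ₐ[k] R} {ι : Type*} {C : ι → Coring k A} {D : Coring k A}
    {p : ∀ i, CoringHom (C i) D} (hp : IsSpanning C (fun i => (p i).toBimodHom))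
    (f : BimodHom A D (RDual φ)) (s : ∀ i, BimodHom A (C i) (RDual φ))
    (hs : ∀ i, IsDualPairing (s i)) (e : ∀ i x, f (p i x) = s i x) : IsDualPairing f where
  map_mul c x y := hp.hom_congr
    (f := AddMonoidHom.mk' (fun c => f c (x * y)) (fun c d => by rw [f.apply_add]; rfl))
    (g := (convAt f x y).comp D.comul.toAddMonoidHom) (fun i c => by
      have h := (hs i).map_mul c x y
      rw [← show f.comp (p i).toBimodHom = s i from BimodHom.ext (e i)] at h
      refine h.trans ((convAt_sq (p i).toBimodHom f x y _).symm.trans ?_)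
      exact congrArg (convAt f x y) ((p i).comul_apply c).symm) c
  map_one c := hp.hom_congr
    (f := AddMonoidHom.mk' (fun c => f c 1) (fun c d => by rw [f.apply_add]; rfl))
    (g := D.counit.toAddMonoidHom)
    (fun i c => (congrArg (fun h : RDual φ => h 1) (e i c)).trans
      (((hs i).map_one c).trans ((p i).map_counit c).symm)) c

section DirectSum

variable {ι : Type u} (C : ι → Coring k A)

open scoped Classical in
/-- The inclusion of a summand of a direct sum of bimodules. -/
noncomputable def sumIncl (i : ι) : BimodHom A (C i) (⨁ i, C i) where
  __ := DirectSum.of (fun i => C i) i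
  map_lsmul a x := (DirectSum.lof A ι (fun i => C i) i).map_smul a x
  map_rsmul a x := (DirectSum.lof Aᵐᵒᵖ ι (fun i => C i) i).map_smul a x

theorem isSpanning_sumIncl : IsSpanning C (sumIncl C) := fun S hS => by
  classical
  refine (AddSubgroup.eq_top_iff' S).2 fun x => ?_
  induction x using DirectSum.induction_on with
  | zero => exact zero_mem S
  | of i x => exact hS i x
  | add x y hx hy => exact add_mem hx hy

/-- The bimodule map out of a direct sum given by bimodule maps on the summands. -/
theorem exists_sumLift {V : Type u} [AddCommGroup V] [Module A V] [Module Aᵐᵒᵖ V]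
    (g : ∀ i, BimodHom A (C i) V) :
    ∃ h : BimodHom A (⨁ i, C i) V, ∀ i c, h (sumIncl C i c) = g i c := by
  classical
  have h : ∀ i c, DirectSum.toAddMonoid (fun i => (g i).toAddMonoidHom) (sumIncl C i c) = g i c :=
    fun i c => DirectSum.toAddMonoid_of (fun i => (g i).toAddMonoidHom) i c
  exact ⟨(isSpanning_sumIncl C).bimodHom _ g h, h⟩

/-- The direct sum of corings. -/
noncomputable def sumCoring : Coring k A :=
  Coring.ofSpanning (isSpanning_sumIncl C)
    (exists_sumLift C fun i => (sumIncl C i).sqHom.comp (C i).comul).choose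
    (exists_sumLift C fun i => (C i).counit).choose
    (exists_sumLift C fun i => (sumIncl C i).sqHom.comp (C i).comul).choose_spec
    (exists_sumLift C fun i => (C i).counit).choose_spec

/-- The inclusion of a summand of a direct sum of corings. -/
noncomputable def sumInclHom (i : ι) : CoringHom (C i) (sumCoring C) where
  __ := sumIncl C i
  map_comul := (exists_sumLift C fun i => (sumIncl C i).sqHom.comp (C i).comul).choose_spec i
  map_counit := (exists_sumLift C fun i => (C i).counit).choose_spec i

/-- The coring morphism out of a direct sum given by coring morphisms on the summands. -/
theorem exists_sumLiftHom {D : Coring k A} (g : ∀ i, CoringHom (C i) D) :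
    ∃ h : CoringHom (sumCoring C) D, ∀ i c, h (sumInclHom C i c) = g i c := by
  obtain ⟨h, hh⟩ := exists_sumLift C fun i => (g i).toBimodHom
  refine ⟨⟨h, ?_, ?_⟩, hh⟩
  · refine (isSpanning_sumIncl C).hom_congr (f := D.comul.toAddMonoidHom.comp h.toAddMonoidHom)
      (g := h.sq.comp (sumCoring C).comul.toAddMonoidHom) fun i c => ?_
    change D.comul (h (sumIncl C i c)) = h.sq ((sumCoring C).comul (sumInclHom C i c))
    rw [hh]
    refine ((g i).map_comul c).trans (Eq.trans ?_ ((h.sq_comp (sumIncl C i) _).trans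
      (congrArg h.sq ((sumInclHom C i).map_comul c).symm)))
    rw [show h.comp (sumIncl C i) = (g i).toBimodHom from BimodHom.ext (hh i)]
    rfl
  · refine (isSpanning_sumIncl C).hom_congr (f := D.counit.toAddMonoidHom.comp h.toAddMonoidHom)
      (g := (sumCoring C).counit.toAddMonoidHom) fun i c => ?_
    exact (congrArg D.counit (hh i c)).trans
      (((g i).map_counit c).trans ((sumInclHom C i).map_counit c).symm)

end DirectSum
end Cover

/-! ### Coideals and separated pairings -/

section Coideals

variable {k A R : Type u} [Field k] [CommRing A] [Algebra k A] [Ring R] [Algebra k R]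

/-- A sub-bimodule `N` of a coring `C` with `Δ(N) ⊆ ker (C ⊗_A C → C/N ⊗_A C/N)`. The condition is
stated for all bimodule maps that kill `N`, that is, those that factor through `C/N`. Nothing is
required of the counit: the coideals below lie in the kernel of a compatible map, hence in that of
the counit. -/
def IsCoideal {C : Coring k A} (N : SubBimod A C) : Prop :=
  ∀ (Y : Type u) [AddCommGroup Y] [Module A Y] [Module Aᵐᵒᵖ Y] (h : BimodHom A C Y),
    (∀ x ∈ N.toSubmodule, h x = 0) → ∀ x ∈ N.toSubmodule, h.sq (C.comul x) = 0

theorem exists_projLift {C : Coring k A} (N : SubBimod A C) {V : Type*} [AddCommGroup V]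
    [Module A V] [Module Aᵐᵒᵖ V] (h : BimodHom A C V) (hN : ∀ x ∈ N.toSubmodule, h x = 0) :
    ∃ g : BimodHom A (C ⧸ N.toSubmodule) V, ∀ x, g (N.proj x) = h x := by
  obtain ⟨g, hg⟩ := N.proj.exists_factor N.proj_surjective h fun x hx =>
    hN x (N.proj_eq_zero.1 hx)
  exact ⟨g, fun x => congrArg (fun h : BimodHom A C V => h x) hg⟩

theorem IsCoideal.exists_comul {C : Coring k A} {N : SubBimod A C} (hN : IsCoideal N) :
    ∃ g : BimodHom A (C ⧸ N.toSubmodule) (BTensor A (C ⧸ N.toSubmodule) (C ⧸ N.toSubmodule)),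
      ∀ x, g (N.proj x) = N.proj.sq (C.comul x) :=
  exists_projLift N (N.proj.sqHom.comp C.comul)
    (hN _ N.proj fun _ hx => N.proj_eq_zero.2 hx)

section Quotient

variable {C : Coring k A} {N : SubBimod A C} (hN : IsCoideal N)
  (hε : ∀ x ∈ N.toSubmodule, C.counit x = 0)

/-- The quotient of a coring by a coideal on which the counit vanishes. -/
noncomputable def quotCoring : Coring k A :=
  Coring.ofSpanning (isSpanning_of_surjective N.proj_surjective)
    hN.exists_comul.choose (exists_projLift N C.counit hε).choose
    (fun _ => hN.exists_comul.choose_spec) (fun _ => (exists_projLift N C.counit hε).choose_spec)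

/-- The projection of a coring to its quotient by a coideal. -/
noncomputable def quotProj : CoringHom C (quotCoring hN hε) where
  __ := N.proj
  map_comul := hN.exists_comul.choose_spec
  map_counit := (exists_projLift N C.counit hε).choose_spec

theorem quotProj_surjective : Function.Surjective (quotProj hN hε) := N.proj_surjective

theorem quotProj_eq_zero {x : C} : quotProj hN hε x = 0 ↔ x ∈ N.toSubmodule := N.proj_eq_zero

end Quotient

variable {φ : A →ₐ[k] R}

theorem IsDualPairing.comp {C D : Coring k A} {f : BimodHom A D (RDual φ)} (hf : IsDualPairing f)
    (g : CoringHom C D) : IsDualPairing (f.comp g.toBimodHom) where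
  map_mul c x y := (hf.map_mul (g c) x y).trans
    ((congrArg (convAt f x y) (g.map_comul c)).trans (convAt_sq g.toBimodHom f x y _))
  map_one c := (hf.map_one (g c)).trans (g.map_counit c)

theorem IsDualPairing.counit_eq_zero {C : Coring k A} {f : BimodHom A C (RDual φ)}
    (hf : IsDualPairing f) {x : C} (hx : f x = 0) : C.counit x = 0 := by
  rw [← hf.map_one, hx]; rfl

/-- A compatible map on `C` descends to the quotient by a coideal on which it vanishes. -/
theorem IsDualPairing.exists_quotient {C : Coring k A} {f : BimodHom A C (RDual φ)}
    (hf : IsDualPairing f) {N : SubBimod A C} (hN : IsCoideal N)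
    (hfN : ∀ x ∈ N.toSubmodule, f x = 0) :
    ∃ (D : Coring k A) (p : CoringHom C D) (g : BimodHom A D (RDual φ)), IsDualPairing g ∧
      Function.Surjective p ∧ (∀ x, p x = 0 ↔ x ∈ N.toSubmodule) ∧ ∀ x, g (p x) = f x := by
  have hε : ∀ x ∈ N.toSubmodule, C.counit x = 0 := fun x hx => hf.counit_eq_zero (hfN x hx)
  obtain ⟨g, hg⟩ := exists_projLift N f hfN
  refine ⟨quotCoring hN hε, quotProj hN hε, g, ?_, quotProj_surjective hN hε,
    fun x => quotProj_eq_zero hN hε, hg⟩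
  exact IsSpanning.isDualPairing (C := fun _ : Unit => C) (p := fun _ => quotProj hN hε)
    (isSpanning_of_surjective (quotProj_surjective hN hε)) g (fun _ => f)
    (fun _ => hf) fun _ => hg

/-- A bimodule map out of a coring is separated if its kernel contains no nonzero coideal. -/
def IsSeparated {C : Coring k A} (f : BimodHom A C (RDual φ)) : Prop :=
  ∀ N : SubBimod A C, IsCoideal N → (∀ x ∈ N.toSubmodule, f x = 0) → ∀ x ∈ N.toSubmodule, x = 0

/-- The image of the difference of two coring morphisms is a coideal. -/
theorem isCoideal_rangeSub {C D : Coring k A} (g g' : CoringHom C D) :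
    IsCoideal (SubBimod.rangeSub g.toBimodHom g'.toBimodHom) := by
  rintro Y _ _ _ h hk _ ⟨x, rfl⟩
  have e : h.comp g.toBimodHom = h.comp g'.toBimodHom := BimodHom.ext fun y => by
    have := hk _ ⟨y, rfl⟩
    exact sub_eq_zero.1 ((h.apply_sub _ _).symm.trans this)
  change h.sq (D.comul (g x - g' x)) = 0
  rw [D.comul.apply_sub, map_sub, g.comul_apply, g'.comul_apply]
  have h1 := h.sq_comp g.toBimodHom (C.comul x)
  rw [e, h.sq_comp] at h1
  exact sub_eq_zero.2 h1.symm

theorem IsSeparated.hom_ext {C D : Coring k A} {f : BimodHom A D (RDual φ)} (hf : IsSeparated f)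
    {g g' : CoringHom C D} (h : ∀ c, f (g c) = f (g' c)) : g = g' := by
  refine CoringHom.ext fun x => sub_eq_zero.1 (hf _ (isCoideal_rangeSub g g') ?_ _ ⟨x, rfl⟩)
  rintro _ ⟨y, rfl⟩
  exact (f.apply_sub _ _).trans (sub_eq_zero.2 (h y))

/-- The universal compatible map is separated: for a coideal `N` in its kernel, the universal
property gives a section of `R^• → R^•/N`. -/
theorem SaftDual.isSeparated (D : SaftDual φ) : IsSeparated D.ξ := fun N hN hξ x hx => by
  obtain ⟨E, p, g, hg, -, hpN, hgp⟩ := D.pairing.exists_quotient hN hξ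
  obtain ⟨s, hs, -⟩ := D.universal E g hg
  have e : s.comp p = CoringHom.id D.coring := (D.universal D.coring D.ξ D.pairing).unique
    (fun c => (hs (p c)).trans (hgp c)) (fun c => rfl)
  have h1 : s (p x) = x := congrArg (fun h : CoringHom D.coring D.coring => h x) e
  rw [← h1, (hpN x).2 hx]
  exact s.apply_zero

/-- The sum of all coideals in the kernel of `f`. -/
def largestCoideal {C : Coring k A} (f : BimodHom A C (RDual φ)) : SubBimod A C :=
  SubBimod.closure {x | ∃ N : SubBimod A C, IsCoideal N ∧ (∀ x ∈ N.toSubmodule, f x = 0) ∧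
      x ∈ N.toSubmodule}
    (fun a _ ⟨N, h, h', hx⟩ => ⟨N, h, h', N.toSubmodule.smul_mem a hx⟩)
    (fun a _ ⟨N, h, h', hx⟩ => ⟨N, h, h', N.rsmul_mem' a hx⟩)

theorem largestCoideal_induction {C : Coring k A} {f : BimodHom A C (RDual φ)} {V : Type*}
    [AddCommGroup V] (g : C →+ V) (hg : ∀ N : SubBimod A C, IsCoideal N →
      (∀ x ∈ N.toSubmodule, f x = 0) → N.toSubmodule ≤ (largestCoideal f).toSubmodule →
      ∀ x ∈ N.toSubmodule, g x = 0) :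
    ∀ x ∈ (largestCoideal f).toSubmodule, g x = 0 := fun x hx => by
  refine (AddSubgroup.closure_le g.ker).2 ?_ hx
  rintro x ⟨N, h, h', hx⟩
  exact hg N h h' (fun y hy => AddSubgroup.subset_closure ⟨N, h, h', hy⟩) x hx

/-- Every compatible map factors through a separated one, along a surjective morphism. -/
theorem IsDualPairing.exists_separated {C : Coring k A} {f : BimodHom A C (RDual φ)}
    (hf : IsDualPairing f) :
    ∃ (D : Coring k A) (p : CoringHom C D) (g : BimodHom A D (RDual φ)), IsDualPairing g ∧
      IsSeparated g ∧ ∀ x, g (p x) = f x := by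
  have h1 : IsCoideal (largestCoideal f) := fun Y _ _ _ h hk =>
    largestCoideal_induction (h.sq.comp C.comul.toAddMonoidHom) fun N hN _ hle =>
      hN Y h fun x hx => hk x (hle hx)
  have h2 : ∀ x ∈ (largestCoideal f).toSubmodule, f x = 0 :=
    largestCoideal_induction f.toAddMonoidHom fun N _ h _ => h
  obtain ⟨D, p, g, hg, hp, hpN, hgp⟩ := hf.exists_quotient h1 h2
  refine ⟨D, p, g, hg, fun M hM hM0 => ?_, hgp⟩
  have h3 : IsCoideal (M.comap p.toBimodHom) := fun Y _ _ _ h hk x hx => by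
    obtain ⟨h', rfl⟩ := p.toBimodHom.exists_factor hp h fun y hy => hk y (by
      change p y ∈ M.toSubmodule
      rw [show p y = 0 from hy]
      exact zero_mem _)
    rw [BimodHom.sq_comp]
    refine (congrArg h'.sq (p.comul_apply x)).symm.trans (hM Y h' (fun y hy => ?_) _ hx)
    obtain ⟨y, rfl⟩ := hp y
    exact hk y hy
  intro y hy
  obtain ⟨x, rfl⟩ := hp y
  exact (hpN x).2 (AddSubgroup.subset_closure
    ⟨_, h3, fun z hz => (hgp z).symm.trans (hM0 _ hz), hy⟩)

/-- If a small family of compatible maps is such that every element of a coring with a compatible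
map is in the image of a member of the family, then a universal compatible map exists: it is the
separated quotient of the direct sum of the family. -/
theorem nonempty_saftDual_of_generators {I : Type u} (S : I → Coring k A)
    (s : ∀ i, BimodHom A (S i) (RDual φ)) (hs : ∀ i, IsDualPairing (s i))
    (gen : ∀ (C : Coring k A) (f : BimodHom A C (RDual φ)), IsDualPairing f → ∀ c : C,
      ∃ (i : I) (g : CoringHom (S i) C), (∀ x, f (g x) = s i x) ∧ ∃ x, g x = c) :
    Nonempty (SaftDual φ) := by
  obtain ⟨σ, hσ⟩ := exists_sumLift S s
  have hσp : IsDualPairing (C := sumCoring S) σ :=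
    IsSpanning.isDualPairing (p := sumInclHom S) (isSpanning_sumIncl S) σ s hs hσ
  obtain ⟨T, q, ξ, hξ, hsep, hξq⟩ := hσp.exists_separated
  refine ⟨T, ξ, hξ, fun C f hf => ?_⟩
  -- `C` is a quotient of the direct sum over all members of the family that map to it; this direct
  -- sum also maps to `T`, and the image in `T` of the kernel of `p` is a coideal.
  let J := Σ i : I, {g : CoringHom (S i) C // ∀ x, f (g x) = s i x}
  obtain ⟨p, hp⟩ := exists_sumLiftHom (fun j : J => S j.1) fun j => j.2.1
  obtain ⟨π, hπ⟩ := exists_sumLiftHom (fun j : J => S j.1) fun j => q.comp (sumInclHom S j.1)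
  have hps : Function.Surjective p := fun c => by
    obtain ⟨i, g, hg, x, rfl⟩ := gen C f hf c
    exact ⟨_, hp ⟨i, g, hg⟩ x⟩
  have hfp : ∀ t, ξ (π t) = f (p t) :=
    (isSpanning_sumIncl fun j : J => S j.1).hom_congr
      (f := ξ.toAddMonoidHom.comp π.toAddMonoidHom) (g := f.toAddMonoidHom.comp p.toAddMonoidHom)
      fun j x => by
        refine (congrArg ξ (hπ j x)).trans (Eq.trans ?_ (congrArg f (hp j x)).symm)
        exact (hξq _).trans ((hσ j.1 x).trans (j.2.2 x).symm)
  have hN : IsCoideal ((SubBimod.ker p.toBimodHom).map π.toBimodHom) := by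
    rintro Y _ _ _ h hk _ ⟨x, hx, rfl⟩
    obtain ⟨h', hh'⟩ := p.toBimodHom.exists_factor hps (h.comp π.toBimodHom)
      fun y hy => hk _ ⟨y, hy, rfl⟩
    change h.sq (T.comul (π x)) = 0
    rw [π.comul_apply, ← BimodHom.sq_comp, ← hh', BimodHom.sq_comp]
    have h1 := p.comul_apply x
    rw [show p x = 0 from hx, C.comul.apply_zero] at h1
    rw [← h1, map_zero]
  obtain ⟨ψ, hψ⟩ := p.toBimodHom.exists_factor hps π.toBimodHom fun y hy =>
    hsep _ hN (by
      rintro _ ⟨x, hx, rfl⟩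
      exact (hfp x).trans ((congrArg f hx).trans f.apply_zero)) _ ⟨y, hy, rfl⟩
  have hψ' : ∀ t, ψ (p t) = π t := fun t => congrArg (fun h : BimodHom A _ T => h t) hψ
  have hψf : ∀ c, ξ (ψ c) = f c := fun c => by
    obtain ⟨t, rfl⟩ := hps c
    rw [hψ', hfp]
  refine ⟨⟨ψ, fun c => ?_, fun c => ?_⟩, hψf, fun g hg =>
    hsep.hom_ext fun c => (hg c).trans (hψf c).symm⟩
  · obtain ⟨t, rfl⟩ := hps c
    change T.comul (ψ (p t)) = ψ.sq (C.comul (p t))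
    rw [hψ', π.comul_apply, p.comul_apply, ← BimodHom.sq_comp, hψ]
  · obtain ⟨t, rfl⟩ := hps c
    rw [hψ']
    exact (π.map_counit t).trans (p.map_counit t).symm

end Coideals

/-! ### Sub-bimodules on which finitely many tensor relations hold -/

section Germs

/-- The families of elements that vanish eventually along a filter. -/
def eventuallyZero {ι : Type*} (F : Filter ι) (G : ι → Type*) [∀ i, AddCommGroup (G i)] :
    AddSubgroup (∀ i, G i) where
  carrier := {f | ∀ᶠ i in F, f i = 0}
  zero_mem' := Filter.Eventually.of_forall fun _ => rfl
  add_mem' {f g} hf hg := by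
    filter_upwards [hf, hg] with i h h'
    rw [Pi.add_apply, h, h', add_zero]
  neg_mem' {f} hf := by
    filter_upwards [hf] with i h
    rw [Pi.neg_apply, h, neg_zero]

/-- The class of a family of elements modulo the families that vanish eventually. -/
def germ {ι : Type*} (F : Filter ι) {G : ι → Type*} [∀ i, AddCommGroup (G i)] (f : ∀ i, G i) :
    (∀ i, G i) ⧸ eventuallyZero F G := QuotientAddGroup.mk' (eventuallyZero F G) f

section

variable {ι : Type*} {F : Filter ι} {G : ι → Type*} [∀ i, AddCommGroup (G i)]

theorem germ_eq {f g : ∀ i, G i} (h : ∀ᶠ i in F, f i = g i) : germ F f = germ F g := by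
  refine QuotientAddGroup.eq.2 ?_
  filter_upwards [h] with i hi
  rw [Pi.add_apply, Pi.neg_apply, hi, neg_add_cancel]

theorem eventually_of_germ_eq_zero {f : ∀ i, G i} (h : germ F f = 0) : ∀ᶠ i in F, f i = 0 :=
  (QuotientAddGroup.eq_zero_iff f).1 h

theorem germ_add (f g : ∀ i, G i) : germ F (fun i => f i + g i) = germ F f + germ F g := rfl

theorem germ_sum {κ : Type*} (s : Finset κ) (f : κ → ∀ i, G i) :
    germ F (fun i => ∑ j ∈ s, f j i) = ∑ j ∈ s, germ F (f j) := by
  refine Eq.trans ?_ (map_sum (QuotientAddGroup.mk' (eventuallyZero F G)) f s)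
  exact congrArg (germ F) (funext fun i => (Finset.sum_apply i s f).symm)

end

variable {A : Type*} [Ring A] {X : Type*} [AddCommGroup X] [Module A X] [Module Aᵐᵒᵖ X]

variable (A X) in
/-- The filter of the sets of sub-bimodules that contain all sub-bimodules above a suitable
countable set. -/
def countablyLarge : Filter (SubBimod A X) where
  sets := {S | ∃ s : Set X, s.Countable ∧ ∀ E : SubBimod A X, s ⊆ E.toSubmodule → E ∈ S}
  univ_sets := ⟨∅, Set.countable_empty, fun _ _ => trivial⟩
  sets_of_superset := fun ⟨s, hs, h⟩ h' => ⟨s, hs, fun E hE => h' (h E hE)⟩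
  inter_sets := fun ⟨s, hs, h⟩ ⟨t, ht, h'⟩ => ⟨s ∪ t, hs.union ht, fun E hE =>
    ⟨h E (Set.subset_union_left.trans hE), h' E (Set.subset_union_right.trans hE)⟩⟩

theorem eventually_mem (x : X) : ∀ᶠ E in countablyLarge A X, x ∈ E.toSubmodule :=
  ⟨{x}, Set.countable_singleton x, fun _ hE => hE rfl⟩

open scoped Classical in
/-- The element `x`, as an element of `E` if it lies there, and `0` otherwise. -/
noncomputable def SubBimod.restrict (E : SubBimod A X) (x : X) : E.toSubmodule :=
  if h : x ∈ E.toSubmodule then ⟨x, h⟩ else 0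

theorem SubBimod.restrict_of_mem {E : SubBimod A X} {x : X} (h : x ∈ E.toSubmodule) :
    E.restrict x = ⟨x, h⟩ := dif_pos h

theorem SubBimod.restrict_coe {E : SubBimod A X} (x : E.toSubmodule) : E.restrict (x : X) = x :=
  dif_pos x.2

theorem eventually_restrict_add (x y : X) : ∀ᶠ E in countablyLarge A X,
    E.restrict (x + y) = E.restrict x + E.restrict y := by
  filter_upwards [eventually_mem x, eventually_mem y] with E hx hy
  rw [SubBimod.restrict_of_mem hx, SubBimod.restrict_of_mem hy,
    SubBimod.restrict_of_mem (add_mem hx hy)]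
  rfl

theorem eventually_restrict_lsmul (a : A) (x : X) : ∀ᶠ E in countablyLarge A X,
    E.restrict (a • x) = a • E.restrict x := by
  filter_upwards [eventually_mem x] with E hx
  rw [SubBimod.restrict_of_mem hx, SubBimod.restrict_of_mem (E.toSubmodule.smul_mem a hx)]
  rfl

theorem eventually_restrict_rsmul (a : Aᵐᵒᵖ) (x : X) : ∀ᶠ E in countablyLarge A X,
    E.restrict (a • x) = a • E.restrict x := by
  filter_upwards [eventually_mem x] with E hx
  rw [SubBimod.restrict_of_mem hx, SubBimod.restrict_of_mem (E.rsmul_mem' a hx)]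
  rfl

/-- A relation in `X ⊗_A X` holds in `E ⊗_A E` for all sufficiently large `E`. -/
theorem eventually_sum_tmul_eq_zero (n : ℕ) (x y : ℕ → X)
    (h : ∑ i ∈ Finset.range n, BTensor.tmul A (x i) (y i) = 0) : ∀ᶠ E in countablyLarge A X,
      ∑ i ∈ Finset.range n, BTensor.tmul A (E.restrict (x i)) (E.restrict (y i)) = 0 := by
  -- The map to the germs of `E ⊗ E` sends a tensor to its restrictions to large `E`.
  let γ : BTensor A X X →+ (∀ E : SubBimod A X, BTensor A E.toSubmodule E.toSubmodule) ⧸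
      eventuallyZero (countablyLarge A X) _ :=
    BTensor.lift A (fun x y => germ (countablyLarge A X) fun E =>
        BTensor.tmul A (E.restrict x) (E.restrict y))
      (fun x x' y => by
        rw [← germ_add]
        refine germ_eq ?_
        filter_upwards [eventually_restrict_add x x'] with E hE
        rw [hE, BTensor.add_tmul])
      (fun x y y' => by
        rw [← germ_add]
        refine germ_eq ?_
        filter_upwards [eventually_restrict_add y y'] with E hE
        rw [hE, BTensor.tmul_add])
      (fun x a y => by
        refine germ_eq ?_
        filter_upwards [eventually_restrict_rsmul (op a) x, eventually_restrict_lsmul a y]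
          with E hE hE'
        rw [hE, hE', BTensor.smul_tmul])
  refine eventually_of_germ_eq_zero ?_
  rw [germ_sum]
  refine Eq.trans ?_ ((congrArg γ h).trans (map_zero γ))
  rw [map_sum]
  rfl

/-- A relation in `(X ⊗_A X) ⊗_A X` holds in `(E ⊗_A E) ⊗_A E` for all sufficiently large `E`. -/
theorem eventually_sum_tmul_tmul_eq_zero [SMulCommClass A Aᵐᵒᵖ X] (n : ℕ) (x y z : ℕ → X)
    (h : ∑ i ∈ Finset.range n, BTensor.tmul A (BTensor.tmul A (x i) (y i)) (z i) = 0) :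
    ∀ᶠ E in countablyLarge A X, ∑ i ∈ Finset.range n, BTensor.tmul A
      (BTensor.tmul A (E.restrict (x i)) (E.restrict (y i))) (E.restrict (z i)) = 0 := by
  let γ' (z : X) : BTensor A X X →+ (∀ E : SubBimod A X,
      BTensor A (BTensor A E.toSubmodule E.toSubmodule) E.toSubmodule) ⧸
      eventuallyZero (countablyLarge A X) _ :=
    BTensor.lift A (fun x y => germ (countablyLarge A X) fun E =>
        BTensor.tmul A (BTensor.tmul A (E.restrict x) (E.restrict y)) (E.restrict z))
      (fun x x' y => by
        rw [← germ_add]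
        refine germ_eq ?_
        filter_upwards [eventually_restrict_add x x'] with E hE
        rw [hE, BTensor.add_tmul, BTensor.add_tmul])
      (fun x y y' => by
        rw [← germ_add]
        refine germ_eq ?_
        filter_upwards [eventually_restrict_add y y'] with E hE
        rw [hE, BTensor.tmul_add, BTensor.add_tmul])
      (fun x a y => by
        refine germ_eq ?_
        filter_upwards [eventually_restrict_rsmul (op a) x, eventually_restrict_lsmul a y]
          with E hE hE'
        rw [hE, hE', BTensor.smul_tmul])
  let γ : BTensor A (BTensor A X X) X →+ (∀ E : SubBimod A X,
      BTensor A (BTensor A E.toSubmodule E.toSubmodule) E.toSubmodule) ⧸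
      eventuallyZero (countablyLarge A X) _ :=
    BTensor.lift A (fun t z => γ' z t)
      (fun t t' z => map_add (γ' z) t t')
      (fun t z z' => BTensor.hom_congr (f := γ' (z + z')) (g := γ' z + γ' z') (fun x y => by
        refine (germ_eq ?_).trans (germ_add _ _)
        filter_upwards [eventually_restrict_add z z'] with E hE
        rw [hE, BTensor.tmul_add]) t)
      (fun t a z => BTensor.hom_congr (f := (γ' z).comp (BTensor.rsmulHom (op a)))
        (g := γ' (a • z)) (fun x y => by
          refine germ_eq ?_
          filter_upwards [eventually_restrict_rsmul (op a) y, eventually_restrict_lsmul a z]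
            with E hE hE'
          rw [hE, hE', ← BTensor.smul_tmul, BTensor.rsmul_tmul]) t)
  refine eventually_of_germ_eq_zero ?_
  rw [germ_sum]
  refine Eq.trans ?_ ((congrArg γ h).trans (map_zero γ))
  rw [map_sum]
  rfl

theorem eventually_mem_range_sq (t : BTensor A X X) :
    ∀ᶠ E in countablyLarge A X, t ∈ E.incl.sq.range := by
  induction t using BTensor.induction_on with
  | zero => exact Filter.Eventually.of_forall fun E => zero_mem _
  | tmul x y =>
    filter_upwards [eventually_mem x, eventually_mem y] with E hx hy
    exact ⟨BTensor.tmul A ⟨x, hx⟩ ⟨y, hy⟩, rfl⟩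
  | add s t hs ht =>
    filter_upwards [hs, ht] with E h h'
    exact add_mem h h'

end Germs

/-! ### Sub-bimodules closed under countably many witnesses -/

section Closure

/-- Terms for the elements of a sub-bimodule generated by one element and closed under operations
that assign to three sequences of elements a sequence of elements. They form a type in the universe
of `A`, which bounds the size of such a sub-bimodule. -/
inductive WitnessTerm (A : Type u) : Type u
  | var : WitnessTerm A
  | add : WitnessTerm A → WitnessTerm A → WitnessTerm A
  | neg : WitnessTerm A → WitnessTerm A
  | lsmul : A → WitnessTerm A → WitnessTerm A
  | rsmul : A → WitnessTerm A → WitnessTerm A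
  | wit : ℕ → (ℕ → WitnessTerm A) → (ℕ → WitnessTerm A) → (ℕ → WitnessTerm A) → ℕ → WitnessTerm A

variable {A X : Type u} [Ring A] [AddCommGroup X] [Module A X] [Module Aᵐᵒᵖ X]

/-- The value of a term. -/
def WitnessTerm.eval (c : X) (w : ℕ → (ℕ → X) → (ℕ → X) → (ℕ → X) → ℕ → X) : WitnessTerm A → X
  | var => c
  | add s t => s.eval c w + t.eval c w
  | neg t => -t.eval c w
  | lsmul a t => a • t.eval c w
  | rsmul a t => op a • t.eval c w
  | wit n x y z j => w n (fun i => (x i).eval c w) (fun i => (y i).eval c w)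
      (fun i => (z i).eval c w) j

/-- A Löwenheim–Skolem argument: if each of the properties `P n x y z` holds for all sufficiently
large sub-bimodules, then some sub-bimodule `E` of bounded size has these properties for all
sequences `x`, `y`, `z` in `E`. -/
theorem exists_closed_subBimod
    (P : ℕ → (ℕ → X) → (ℕ → X) → (ℕ → X) → SubBimod A X → Prop)
    (hP : ∀ n x y z, ∀ᶠ E in countablyLarge A X, P n x y z E) (c : X) :
    ∃ E : SubBimod A X, c ∈ E.toSubmodule ∧
      (∀ (n : ℕ) (x y z : ℕ → E.toSubmodule), P n (fun i => x i) (fun i => y i) (fun i => z i) E) ∧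
      ∃ e : WitnessTerm A → E.toSubmodule, Function.Surjective e := by
  have h : ∀ n x y z, ∃ w : ℕ → X, ∀ E : SubBimod A X, (∀ j, w j ∈ E.toSubmodule) →
      P n x y z E := fun n x y z => by
    obtain ⟨s, hs, h⟩ := hP n x y z
    obtain ⟨w, hw⟩ := Set.countable_iff_exists_subset_range.1 hs
    refine ⟨w, fun E hE => h E fun a ha => ?_⟩
    obtain ⟨j, rfl⟩ := hw ha
    exact hE j
  choose w hw using h
  let E : SubBimod A X :=
    { carrier := Set.range (WitnessTerm.eval (A := A) c w)
      add_mem' := by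
        rintro _ _ ⟨s, rfl⟩ ⟨t, rfl⟩
        exact ⟨.add s t, rfl⟩
      zero_mem' := ⟨.add .var (.neg .var), add_neg_cancel c⟩
      smul_mem' := by
        rintro a _ ⟨t, rfl⟩
        exact ⟨.lsmul a t, rfl⟩
      rsmul_mem' := by
        rintro a _ ⟨t, rfl⟩
        exact ⟨.rsmul a.unop t, rfl⟩ }
  refine ⟨E, ⟨.var, rfl⟩, fun n x y z => hw _ _ _ _ E fun j => ?_,
    fun t => ⟨t.eval c w, t, rfl⟩, fun x => ?_⟩
  · choose x' hx using fun i => (x i).2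
    choose y' hy using fun i => (y i).2
    choose z' hz using fun i => (z i).2
    refine ⟨.wit n x' y' z' j, ?_⟩
    simp only [WitnessTerm.eval, hx, hy, hz]
  · obtain ⟨t, ht⟩ := x.2
    exact ⟨t, Subtype.ext ht⟩

end Closure

/-! ### Small corings generate -/

section Small

theorem exists_sum_range_of_mem_closure {V T : Type*} [AddCommMonoid V] [Nonempty T] (τ : T → V)
    {v : V} (hv : v ∈ AddSubmonoid.closure (Set.range τ)) :
    ∃ (n : ℕ) (x : ℕ → T), v = ∑ i ∈ Finset.range n, τ (x i) := by
  induction hv using AddSubmonoid.closure_induction with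
  | mem v hv =>
    obtain ⟨t, rfl⟩ := hv
    exact ⟨1, fun _ => t, (Finset.sum_range_one fun _ => τ t).symm⟩
  | zero => exact ⟨0, fun _ => Classical.arbitrary T, rfl⟩
  | add v v' _ _ h h' =>
    obtain ⟨n, x, rfl⟩ := h
    obtain ⟨m, y, rfl⟩ := h'
    refine ⟨n + m, fun i => if i < n then x i else y (i - n), ?_⟩
    rw [Finset.sum_range_add]
    congr 1
    · exact Finset.sum_congr rfl fun i hi =>
        congrArg τ (if_pos (Finset.mem_range.1 hi)).symm
    · exact Finset.sum_congr rfl fun i _ => congrArg τ (by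
        simp only [Nat.add_sub_cancel_left, if_neg (Nat.not_lt.2 (Nat.le_add_right n i))])

theorem BTensor.exists_sum_tmul {A M N : Type*} [Ring A] [AddCommGroup M] [AddCommGroup N]
    [Module Aᵐᵒᵖ M] [Module A N] (t : BTensor A M N) :
    ∃ (n : ℕ) (x : ℕ → M) (y : ℕ → N), t = ∑ i ∈ Finset.range n, BTensor.tmul A (x i) (y i) := by
  have h : t ∈ AddSubmonoid.closure (Set.range fun p : M × N => BTensor.tmul A p.1 p.2) := by
    induction t using BTensor.induction_on with
    | zero => exact zero_mem _
    | tmul m n => exact AddSubmonoid.subset_closure ⟨(m, n), rfl⟩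
    | add x y hx hy => exact add_mem hx hy
  obtain ⟨n, x, hx⟩ := exists_sum_range_of_mem_closure _ h
  exact ⟨n, fun i => (x i).1, fun i => (x i).2, hx⟩

theorem BTensor.exists_sum_tmul_tmul {A M N L : Type*} [Ring A] [AddCommGroup M] [AddCommGroup N]
    [AddCommGroup L] [Module Aᵐᵒᵖ M] [Module A N] [Module Aᵐᵒᵖ N] [SMulCommClass A Aᵐᵒᵖ N]
    [Module A L] (t : BTensor A (BTensor A M N) L) :
    ∃ (n : ℕ) (x : ℕ → M) (y : ℕ → N) (z : ℕ → L),
      t = ∑ i ∈ Finset.range n, BTensor.tmul A (BTensor.tmul A (x i) (y i)) (z i) := by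
  have h : t ∈ AddSubmonoid.closure (Set.range fun p : M × N × L =>
      BTensor.tmul A (BTensor.tmul A p.1 p.2.1) p.2.2) := by
    induction t using BTensor.induction_on with
    | zero => exact zero_mem _
    | tmul s l =>
      induction s using BTensor.induction_on with
      | zero =>
        have h0 : BTensor.tmul A (0 : BTensor A M N) l = 0 :=
          map_zero (AddMonoidHom.mk' (fun s => BTensor.tmul A s l)
            fun s s' => BTensor.add_tmul A s s' l)
        rw [h0]
        exact zero_mem _
      | tmul m n => exact AddSubmonoid.subset_closure ⟨(m, n, l), rfl⟩
      | add x y hx hy => rw [BTensor.add_tmul]; exact add_mem hx hy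
    | add x y hx hy => exact add_mem hx hy
  obtain ⟨n, x, hx⟩ := exists_sum_range_of_mem_closure _ h
  exact ⟨n, fun i => (x i).1, fun i => (x i).2.1, fun i => (x i).2.2, hx⟩

namespace BimodHom

variable {A : Type*} [Ring A] {X Y Z : Type*} [AddCommGroup X] [AddCommGroup Y] [AddCommGroup Z]
  [Module A X] [Module Aᵐᵒᵖ X] [Module A Y] [Module Aᵐᵒᵖ Y] [Module A Z] [Module Aᵐᵒᵖ Z]

theorem sq_comp_injective {g : BimodHom A Y Z} {f : BimodHom A X Y} {f' : BimodHom A Y X}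
    (hg : Function.Injective g.sq) (hf : f'.comp f = BimodHom.id A X) :
    Function.Injective (g.comp f).sq := fun t t' h => by
  rw [sq_comp, sq_comp] at h
  have := congrArg f'.sq (hg h)
  rwa [← sq_comp, ← sq_comp, hf, sq_id, sq_id] at this

theorem apply_apply_of_comp_eq_id {f : BimodHom A X Y} {f' : BimodHom A Y X}
    (hf : f'.comp f = BimodHom.id A X) (x : X) : f' (f x) = x :=
  congrArg (fun h : BimodHom A X X => h x) hf

theorem comp_injective {g : BimodHom A Y Z} {f : BimodHom A X Y} {f' : BimodHom A Y X}
    (hg : Function.Injective g) (hf : f'.comp f = BimodHom.id A X) :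
    Function.Injective (g.comp f) := fun x x' h => by
  rw [← apply_apply_of_comp_eq_id hf x, ← apply_apply_of_comp_eq_id hf x']
  exact congrArg f' (hg h)

theorem range_sq_le_comp {g : BimodHom A Y Z} {f : BimodHom A X Y} {f' : BimodHom A Y X}
    (hf : f.comp f' = BimodHom.id A Y) : g.sq.range ≤ (g.comp f).sq.range := by
  rintro _ ⟨t, rfl⟩
  refine ⟨f'.sq t, ?_⟩
  rw [sq_comp, ← sq_comp f, hf, sq_id]

variable [SMulCommClass A Aᵐᵒᵖ X] [SMulCommClass A Aᵐᵒᵖ Y] [SMulCommClass A Aᵐᵒᵖ Z]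

/-- `(h ⊗_A h) ⊗_A h`. -/
def cube (h : BimodHom A X Y) : BTensor A (BTensor A X X) X →+ BTensor A (BTensor A Y Y) Y :=
  BTensor.map h.sqHom.right h.left

theorem cube_comp (g : BimodHom A Y Z) (f : BimodHom A X Y) (t : BTensor A (BTensor A X X) X) :
    (g.comp f).cube t = g.cube (f.cube t) := by
  refine BTensor.hom_congr (f := (g.comp f).cube) (g := g.cube.comp f.cube) (fun s x => ?_) t
  exact congrArg (BTensor.tmul A · (g (f x))) (g.sq_comp f s)

theorem cube_id (t : BTensor A (BTensor A X X) X) : (BimodHom.id A X).cube t = t := by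
  refine BTensor.hom_congr (f := (BimodHom.id A X).cube) (g := .id _) (fun s x => ?_) t
  exact congrArg (BTensor.tmul A · x) (sq_id s)

theorem cube_comp_injective {g : BimodHom A Y Z} {f : BimodHom A X Y} {f' : BimodHom A Y X}
    (hg : Function.Injective g.cube) (hf : f'.comp f = BimodHom.id A X) :
    Function.Injective (g.comp f).cube := fun t t' h => by
  rw [cube_comp, cube_comp] at h
  have := congrArg f'.cube (hg h)
  rwa [← cube_comp, ← cube_comp, hf, cube_id, cube_id] at this

end BimodHom

variable {k A R : Type u} [Field k] [CommRing A] [Algebra k A] [Ring R] [Algebra k R]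

variable (k A) in
/-- An `A`-coring structure on a given type. Unlike the type of all corings, the type of these
structures is as small as the given type. -/
structure CoringOn (X : Type u) where
  [addCommGroup : AddCommGroup X]
  [leftModule : Module A X]
  [rightModule : Module Aᵐᵒᵖ X]
  [smulComm : SMulCommClass A Aᵐᵒᵖ X]
  central : ∀ (r : k) (c : X), algebraMap k A r • c = op (algebraMap k A r) • c
  comul : BimodHom A X (BTensor A X X)
  counit : BimodHom A X A
  coassoc : ∀ c, BTensor.map comul.right LinearMap.id (comul c) =
    BTensor.assoc A X X X (BTensor.map LinearMap.id comul.left (comul c))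
  counit_left : ∀ c, BTensor.lid A X (BTensor.map counit.right LinearMap.id (comul c)) = c
  counit_right : ∀ c, BTensor.rid A X (BTensor.map LinearMap.id counit.left (comul c)) = c

/-- The coring given by a coring structure on a type. -/
def CoringOn.toCoring {X : Type u} (c : CoringOn k A X) : Coring k A :=
  { c with carrier := X }

/-- A bimodule that embeds in a coring `C`, compatibly with the comultiplication, such that its
second and third tensor powers embed in those of `C`, is a coring. -/
theorem exists_coringOn {C : Coring k A} {X : Type u} [AddCommGroup X] [Module A X]
    [Module Aᵐᵒᵖ X] [SMulCommClass A Aᵐᵒᵖ X] (j : BimodHom A X C) (h1 : Function.Injective j)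
    (h2 : Function.Injective j.sq) (h3 : Function.Injective j.cube)
    (hΔ : ∀ x, C.comul (j x) ∈ j.sq.range) :
    ∃ (c : CoringOn k A X) (g : CoringHom c.toCoring C), ∀ x : X, g x = j x := by
  choose d hd using hΔ
  let Δ : BimodHom A X (BTensor A X X) :=
    ⟨AddMonoidHom.mk' d fun x y => h2 (by
        rw [map_add, hd, hd, hd, j.apply_add, C.comul.apply_add]),
      fun a x => h2 (by
        change j.sqHom (d (a • x)) = j.sqHom (a • d x)
        rw [j.sqHom.map_lsmul]
        change j.sq (d (a • x)) = a • j.sq (d x)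
        rw [hd, hd, j.map_lsmul, C.comul.map_lsmul]),
      fun a x => h2 (by
        change j.sqHom (d (a • x)) = j.sqHom (a • d x)
        rw [j.sqHom.map_rsmul]
        change j.sq (d (a • x)) = a • j.sq (d x)
        rw [hd, hd, j.map_rsmul, C.comul.map_rsmul])⟩
  have hΔ : ∀ x, j.sq (Δ x) = C.comul (j x) := hd
  have e1 : ∀ t, j.cube (BTensor.map Δ.right LinearMap.id t) =
      BTensor.map C.comul.right LinearMap.id (j.sq t) :=
    BTensor.hom_congr (f := j.cube.comp (BTensor.map Δ.right LinearMap.id))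
      (g := (BTensor.map C.comul.right LinearMap.id).comp j.sq)
      fun x y => congrArg (BTensor.tmul A · (j y)) (hΔ x)
  have e2 : ∀ t, BTensor.map j.right j.sqHom.left (BTensor.map LinearMap.id Δ.left t) =
      BTensor.map LinearMap.id C.comul.left (j.sq t) :=
    BTensor.hom_congr (f := (BTensor.map j.right j.sqHom.left).comp
        (BTensor.map LinearMap.id Δ.left))
      (g := (BTensor.map LinearMap.id C.comul.left).comp j.sq)
      fun x y => congrArg (BTensor.tmul A (j x)) (hΔ y)
  let ε : BimodHom A X A := C.counit.comp j
  have e3 : ∀ t, j (BTensor.lid A X (BTensor.map ε.right LinearMap.id t)) =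
      BTensor.lid A C (BTensor.map C.counit.right LinearMap.id (j.sq t)) :=
    BTensor.hom_congr (f := j.toAddMonoidHom.comp
        ((BTensor.lid A X).comp (BTensor.map ε.right LinearMap.id)))
      (g := (BTensor.lid A C).comp ((BTensor.map C.counit.right LinearMap.id).comp j.sq))
      fun x y => j.map_lsmul _ y
  have e4 : ∀ t, j (BTensor.rid A X (BTensor.map LinearMap.id ε.left t)) =
      BTensor.rid A C (BTensor.map LinearMap.id C.counit.left (j.sq t)) :=
    BTensor.hom_congr (f := j.toAddMonoidHom.comp
        ((BTensor.rid A X).comp (BTensor.map LinearMap.id ε.left)))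
      (g := (BTensor.rid A C).comp ((BTensor.map LinearMap.id C.counit.left).comp j.sq))
      fun x y => j.map_rsmul _ x
  refine ⟨{
    central := fun r x => h1 (by rw [j.map_lsmul, j.map_rsmul, C.central])
    comul := Δ
    counit := ε
    coassoc := fun x => h3 (by
      refine (e1 _).trans (Eq.trans ?_ (j.assoc_sq _).symm)
      rw [e2, hΔ, C.coassoc])
    counit_left := fun x => h1 (by rw [e3, hΔ, C.counit_left])
    counit_right := fun x => h1 (by rw [e4, hΔ, C.counit_right]) },
    ⟨j, fun x => (hΔ x).symm, fun x => rfl⟩, fun x => rfl⟩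

/-- Every element of a coring lies in a subcoring of bounded size `E`, such that the second and
third tensor powers of `E` embed in those of the coring. -/
theorem exists_small_subBimod (C : Coring k A) (c : C) :
    ∃ E : SubBimod A C, c ∈ E.toSubmodule ∧ Function.Injective E.incl.sq ∧
      Function.Injective E.incl.cube ∧ (∀ x, C.comul (E.incl x) ∈ E.incl.sq.range) ∧
      ∃ e : WitnessTerm A → E.toSubmodule, Function.Surjective e := by
  obtain ⟨E, hc, hE, he⟩ := exists_closed_subBimod (A := A) (X := C)
    (fun n x y z E =>
      (∑ i ∈ Finset.range n, BTensor.tmul A (x i) (y i) = 0 →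
        ∑ i ∈ Finset.range n, BTensor.tmul A (E.restrict (x i)) (E.restrict (y i)) = 0) ∧
      (∑ i ∈ Finset.range n, BTensor.tmul A (BTensor.tmul A (x i) (y i)) (z i) = 0 →
        ∑ i ∈ Finset.range n, BTensor.tmul A
          (BTensor.tmul A (E.restrict (x i)) (E.restrict (y i))) (E.restrict (z i)) = 0) ∧
      C.comul (x 0) ∈ E.incl.sq.range)
    (fun n x y z => by
      refine Filter.Eventually.and ?_ (Filter.Eventually.and ?_ (eventually_mem_range_sq _))
      · by_cases h : ∑ i ∈ Finset.range n, BTensor.tmul A (x i) (y i) = 0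
        · filter_upwards [eventually_sum_tmul_eq_zero n x y h] with E hE _ using hE
        · exact Filter.Eventually.of_forall fun E h' => absurd h' h
      · by_cases h : ∑ i ∈ Finset.range n, BTensor.tmul A (BTensor.tmul A (x i) (y i)) (z i) = 0
        · filter_upwards [eventually_sum_tmul_tmul_eq_zero n x y z h] with E hE _ using hE
        · exact Filter.Eventually.of_forall fun E h' => absurd h' h) c
  simp only [SubBimod.restrict_coe] at hE
  refine ⟨E, hc, (injective_iff_map_eq_zero _).2 fun t ht => ?_,
    (injective_iff_map_eq_zero _).2 fun t ht => ?_, fun x => (hE 0 (fun _ => x) 0 0).2.2, he⟩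
  · obtain ⟨n, x, y, rfl⟩ := t.exists_sum_tmul
    refine (hE n x y 0).1 (Eq.trans ?_ ht)
    rw [map_sum]
    rfl
  · obtain ⟨n, x, y, z, rfl⟩ := t.exists_sum_tmul_tmul
    refine (hE n x y z).2.1 (Eq.trans ?_ ht)
    rw [map_sum]
    rfl

/-- A bimodule structure can be transported along a bijection. -/
theorem exists_bimodule_of_equiv {X Y : Type u} [AddCommGroup Y] [Module A Y] [Module Aᵐᵒᵖ Y]
    [SMulCommClass A Aᵐᵒᵖ Y] (q : X ≃ Y) :
    ∃ (_ : AddCommGroup X) (_ : Module A X) (_ : Module Aᵐᵒᵖ X) (_ : SMulCommClass A Aᵐᵒᵖ X)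
      (i : BimodHom A X Y) (i' : BimodHom A Y X),
      i'.comp i = BimodHom.id A X ∧ i.comp i' = BimodHom.id A Y := by
  let g := q.addCommGroup
  let l := q.module A
  let r := q.module Aᵐᵒᵖ
  have c : SMulCommClass A Aᵐᵒᵖ X := ⟨fun a b x => q.injective (by
    refine ((q.linearEquiv A).map_smul a (b • x)).trans (Eq.trans ?_
      ((q.linearEquiv Aᵐᵒᵖ).map_smul b (a • x)).symm)
    refine (congrArg (a • ·) ((q.linearEquiv Aᵐᵒᵖ).map_smul b x)).trans (Eq.trans ?_
      (congrArg (b • ·) ((q.linearEquiv A).map_smul a x)).symm)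
    exact smul_comm a b (q x))⟩
  exact ⟨g, l, r, c,
    ⟨(q.linearEquiv A).toLinearMap.toAddMonoidHom, (q.linearEquiv A).map_smul,
      (q.linearEquiv Aᵐᵒᵖ).map_smul⟩,
    ⟨(q.linearEquiv A).symm.toLinearMap.toAddMonoidHom, (q.linearEquiv A).symm.map_smul,
      (q.linearEquiv Aᵐᵒᵖ).symm.map_smul⟩,
    BimodHom.ext q.symm_apply_apply, BimodHom.ext q.apply_symm_apply⟩

theorem exists_small_coring (C : Coring k A) (c : C) :
    ∃ (s : Setoid (WitnessTerm A)) (S : CoringOn k A (Quotient s)) (g : CoringHom S.toCoring C),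
      ∃ x, g x = c := by
  obtain ⟨E, hc, h2, h3, hΔ, e, he⟩ := exists_small_subBimod C c
  obtain ⟨_, _, _, _, i, i', hi, hi'⟩ :=
    exists_bimodule_of_equiv (A := A) (Setoid.quotientKerEquivOfSurjective e he)
  obtain ⟨S, g, hg⟩ := exists_coringOn (E.incl.comp i)
    (BimodHom.comp_injective E.incl_injective hi) (BimodHom.sq_comp_injective h2 hi)
    (BimodHom.cube_comp_injective h3 hi) fun x => BimodHom.range_sq_le_comp hi' (hΔ (i x))
  refine ⟨_, S, g, i' ⟨c, hc⟩, (hg _).trans ?_⟩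
  rw [BimodHom.comp_apply, BimodHom.apply_apply_of_comp_eq_id hi']
  rfl

/-- A coring of bounded size with a compatible map; these form a type in the universe of the
corings. -/
structure BoundedPairing (φ : A →ₐ[k] R) where
  rel : Setoid (WitnessTerm A)
  str : CoringOn k A (Quotient rel)
  toDual : BimodHom A str.toCoring (RDual φ)
  pairing : IsDualPairing toDual

/-- The universal compatible map exists. -/
theorem nonempty_saftDual (φ : A →ₐ[k] R) : Nonempty (SaftDual φ) := by
  refine nonempty_saftDual_of_generators (I := BoundedPairing φ) (fun i => i.str.toCoring)
    (fun i => i.toDual) (fun i => i.pairing) fun C f hf c => ?_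
  obtain ⟨s, S, g, hg⟩ := exists_small_coring C c
  exact ⟨⟨s, S, f.comp g.toBimodHom, hf.comp g⟩, g, fun _ => rfl, hg⟩

end Small

/-! ### Coefficients of comodules -/

section Coefficients

variable {k A R : Type u} [Field k] [CommRing A] [Algebra k A] [Ring R] [Algebra k R]

/-- The contraction `m ⊗ c ↦ q(m) c`. -/
def contract {A M C : Type*} [Ring A] [AddCommGroup M] [AddCommGroup C] [Module Aᵐᵒᵖ M]
    [Module A C] (q : M →ₗ[Aᵐᵒᵖ] A) : BTensor A M C →+ C :=
  (BTensor.lid A C).comp (BTensor.map q LinearMap.id)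

/-- The contraction as a right linear map. -/
def contractRight {A M C : Type*} [Ring A] [AddCommGroup M] [AddCommGroup C] [Module Aᵐᵒᵖ M]
    [Module A C] [Module Aᵐᵒᵖ C] [SMulCommClass A Aᵐᵒᵖ C] (q : M →ₗ[Aᵐᵒᵖ] A) :
    BTensor A M C →ₗ[Aᵐᵒᵖ] C where
  __ := contract q
  map_smul' a := BTensor.hom_congr (f := (contract q).comp (BTensor.rsmulHom a))
    (g := (DistribSMul.toAddMonoidHom C a).comp (contract q)) fun m c => smul_comm (q m) a c

theorem DualBasis.sum_tmul_contract {V : ModuleCat.{u} Aᵐᵒᵖ} (b : DualBasis V) {C : Type u}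
    [AddCommGroup C] [Module A C] (t : BTensor A V C) :
    ∑ j, BTensor.tmul A (b.e j) (contract (b.e' j) t) = t := by
  induction t using BTensor.induction_on with
  | zero =>
    refine Finset.sum_eq_zero fun j _ => ?_
    rw [map_zero]
    exact map_zero (AddMonoidHom.mk' (fun c => BTensor.tmul A (b.e j) c)
      (BTensor.tmul_add A (b.e j)))
  | tmul v c =>
    conv_rhs => rw [← b.sum_eq v, BTensor.sum_tmul]
    exact Finset.sum_congr rfl fun j _ => (BTensor.smul_tmul A _ _ _).symm
  | add s t hs ht =>
    conv_rhs => rw [← hs, ← ht, ← Finset.sum_add_distrib]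
    exact Finset.sum_congr rfl fun j _ => by rw [map_add, BTensor.tmul_add]

variable {C : Coring k A}

/-- The coefficient `q(m₍₀₎) m₍₁₎` of a comodule. -/
def Comod.coeff (M : Comod C) (q : M.toMod →ₗ[Aᵐᵒᵖ] A) : M.toMod →ₗ[Aᵐᵒᵖ] C :=
  contractRight q ∘ₗ M.coact

theorem Comod.coact_eq_sum (M : Comod C) (b : DualBasis M.toMod) (m : M.toMod) :
    M.coact m = ∑ j, BTensor.tmul A (b.e j) (M.coeff (b.e' j) m) :=
  (b.sum_tmul_contract (M.coact m)).symm

theorem Comod.coeff_smul (M : Comod C) (a : A) (q : M.toMod →ₗ[Aᵐᵒᵖ] A) (m : M.toMod) :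
    M.coeff (a • q) m = a • M.coeff q m :=
  BTensor.hom_congr (f := contract (a • q)) (g := (DistribSMul.toAddMonoidHom C a).comp (contract q))
    (fun m c => mul_smul a (q m) c) (M.coact m)

/-- The coefficients of a comodule span a comatrix coring. -/
theorem Comod.comul_coeff (M : Comod C) (b : DualBasis M.toMod) (q : M.toMod →ₗ[Aᵐᵒᵖ] A)
    (m : M.toMod) : C.comul (M.coeff q m) =
      ∑ j, BTensor.tmul A (M.coeff q (b.e j)) (M.coeff (b.e' j) m) := by
  have h : C.comul (contract q (M.coact m)) = BTensor.map (contractRight q) LinearMap.id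
      (BTensor.assoc A M.toMod C C (BTensor.map LinearMap.id C.comul.left (M.coact m))) :=
    BTensor.hom_congr (f := C.comul.toAddMonoidHom.comp (contract q))
      (g := (BTensor.map (contractRight q) LinearMap.id).comp
        ((BTensor.assoc A M.toMod C C).comp (BTensor.map LinearMap.id C.comul.left)))
      (fun v c => (C.comul.map_lsmul (q v) c).trans
        (BTensor.hom_congr (f := BTensor.lsmulHom (q v))
          (g := (BTensor.map (contractRight q) LinearMap.id).comp (BTensor.assocAux v))
          (fun _ _ => rfl) (C.comul c))) _
  refine h.trans ?_
  rw [← M.coassoc, M.coact_eq_sum b m, map_sum, map_sum]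
  rfl

/-- The pairing of a coefficient with `r` is the coefficient of the action of `r`. -/
theorem Comod.pair_coeff {φ : A →ₐ[k] R} (f : BimodHom A C (RDual φ)) (M : Comod C)
    (q : M.toMod →ₗ[Aᵐᵒᵖ] A) (m : M.toMod) (r : R) :
    f (M.coeff q m) r = q (comodAct f M r m) := by
  refine BTensor.hom_congr (f := (evalAt f r).toAddMonoidHom.comp (contract q))
    (g := q.toAddMonoidHom.comp (actAux f M.toMod r)) (fun v c => ?_) (M.coact m)
  change f (q v • c) r = q (op (f c r) • v)
  rw [f.map_lsmul, q.map_smul]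
  rfl

end Coefficients

/-! ### The two functors are mutually inverse -/

section Functors

variable {k A R : Type u} [Field k] [CommRing A] [Algebra k A] [Ring R] [Algebra k R]
  {φ : A →ₐ[k] R}

theorem circZeta_circMk (M : FGPMod φ) (q : M.Dual) (m : M.toMod) (r : R) :
    circZeta φ (circMk M q m) r = q (M.ract r m) := by
  refine (Comatrix.zetaHom_mk (circObj φ) M.idx _ _ r).trans ?_
  rw [LinearMap.comp_apply, FGPMod.toLin_ract, FGPMod.inv_hom_apply]

namespace SaftDual

variable (D : SaftDual φ)

theorem ξ_zetaHat (c : circ φ) : D.ξ (D.zetaHat c) = circZeta φ c :=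
  (D.universal _ _ (isDualPairing_circZeta φ)).choose_spec.1 c

section

variable (M : FGPComod D.coring)

/-- The identity of a comodule, as a right `A`-linear equivalence with the module underlying the
`R`-module that `ℒ'` assigns to it. -/
noncomputable def equivL : (D.functorL.obj M).toMod ≃ₗ[Aᵐᵒᵖ] M.obj.toMod where
  __ := AddEquiv.refl M.obj.toMod
  map_smul' a m := comodAct_map D.pairing M.obj a.unop m

/-- A dual basis of a comodule over `R^•`. -/
noncomputable def dualBasisL : DualBasis M.obj.toMod where
  n := (D.functorL.obj M).dualBasis.n
  e j := D.equivL M ((D.functorL.obj M).dualBasis.e j)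
  e' j := (D.functorL.obj M).dualBasis.e' j ∘ₗ (D.equivL M).symm.toLinearMap
  sum_eq m := by
    conv_rhs => rw [← (D.equivL M).apply_symm_apply m,
      ← (D.functorL.obj M).dualBasis.sum_eq ((D.equivL M).symm m), map_sum]
    exact Finset.sum_congr rfl fun j _ => ((D.equivL M).map_smul _ _).symm

/-- The image in `R^•` of the class of `q ⊗ m` in `R^∘`, for a comodule over `R^•`. -/
noncomputable def hatMk (q : M.obj.toMod →ₗ[Aᵐᵒᵖ] A) (m : M.obj.toMod) : D.coring :=
  D.zetaHat (circMk (D.functorL.obj M) (q ∘ₗ (D.equivL M).toLinearMap) ((D.equivL M).symm m))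

theorem comul_hatMk (q : M.obj.toMod →ₗ[Aᵐᵒᵖ] A) (m : M.obj.toMod) :
    D.coring.comul (D.hatMk M q m) = ∑ j, BTensor.tmul A (D.hatMk M q ((D.dualBasisL M).e j))
      (D.hatMk M ((D.dualBasisL M).e' j) m) := by
  refine (D.zetaHat.comul_apply _).trans ?_
  rw [comul_circMk, map_sum]
  rfl

theorem ξ_hatMk (q : M.obj.toMod →ₗ[Aᵐᵒᵖ] A) (m : M.obj.toMod) (r : R) :
    D.ξ (D.hatMk M q m) r = q (comodAct D.ξ M.obj r m) := by
  rw [hatMk, ξ_zetaHat, circZeta_circMk]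
  rfl

theorem hatMk_lsmul (a : A) (q : M.obj.toMod →ₗ[Aᵐᵒᵖ] A) (m : M.obj.toMod) :
    D.hatMk M (a • q) m = a • D.hatMk M q m := by
  refine Eq.trans ?_ (D.zetaHat.map_lsmul a _)
  exact congrArg D.zetaHat ((circMkLeft (D.functorL.obj M) ((D.equivL M).symm m)).map_smul a
    (q ∘ₗ (D.equivL M).toLinearMap))

theorem hatMk_rsmul (a : Aᵐᵒᵖ) (q : M.obj.toMod →ₗ[Aᵐᵒᵖ] A) (m : M.obj.toMod) :
    D.hatMk M q (a • m) = a • D.hatMk M q m := by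
  refine Eq.trans ?_ (D.zetaHat.map_rsmul a _)
  refine congrArg D.zetaHat (Eq.trans ?_ ((circMkRight (D.functorL.obj M)
    (q ∘ₗ (D.equivL M).toLinearMap)).map_smul a ((D.equivL M).symm m)))
  rw [← map_smul]
  rfl

/-- The coefficients of a comodule over `R^•` come from `R^∘`. Both families of elements have the
same comultiplication and the same image in `R^*`, so their differences span a coideal in the
kernel of `ξ`. -/
theorem coeff_eq_hatMk (q : M.obj.toMod →ₗ[Aᵐᵒᵖ] A) (m : M.obj.toMod) :
    M.obj.coeff q m = D.hatMk M q m := by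
  let N : SubBimod A D.coring := SubBimod.closure
    {x | ∃ q m, x = M.obj.coeff q m - D.hatMk M q m}
    (by
      rintro a _ ⟨q, m, rfl⟩
      exact ⟨a • q, m, by rw [smul_sub, Comod.coeff_smul, hatMk_lsmul]⟩)
    (by
      rintro a _ ⟨q, m, rfl⟩
      exact ⟨q, a • m, by rw [smul_sub, map_smul, hatMk_rsmul]⟩)
  have hmem : ∀ q m, M.obj.coeff q m - D.hatMk M q m ∈ N.toSubmodule := fun q m =>
    AddSubgroup.subset_closure ⟨q, m, rfl⟩
  have hind : ∀ {V : Type u} [AddCommGroup V] (g : D.coring →+ V),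
      (∀ q m, g (M.obj.coeff q m) = g (D.hatMk M q m)) → ∀ x ∈ N.toSubmodule, g x = 0 :=
    fun g hg x hx => by
      refine (AddSubgroup.closure_le g.ker).2 ?_ hx
      rintro _ ⟨q, m, rfl⟩
      exact (map_sub g _ _).trans (sub_eq_zero.2 (hg q m))
  refine sub_eq_zero.1 (D.isSeparated N (fun Y _ _ _ h hk => ?_) ?_ _ (hmem q m))
  · have hh : ∀ q m, h (M.obj.coeff q m) = h (D.hatMk M q m) := fun q m =>
      sub_eq_zero.1 ((h.apply_sub _ _).symm.trans (hk _ (hmem q m)))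
    refine hind (h.sq.comp D.coring.comul.toAddMonoidHom) fun q m => ?_
    change h.sq (D.coring.comul (M.obj.coeff q m)) = h.sq (D.coring.comul (D.hatMk M q m))
    rw [M.obj.comul_coeff (D.dualBasisL M), comul_hatMk, map_sum, map_sum]
    simp only [BimodHom.sq_tmul, hh]
  · exact hind D.ξ.toAddMonoidHom fun q m => RDual.ext fun r =>
      (M.obj.pair_coeff D.ξ q m r).trans (D.ξ_hatMk M q m r).symm

/-- The comparison `χ'(ℒ'(M)) ⟶ M`, the identity on underlying sets. -/
noncomputable def comparisonComod : (D.functorL ⋙ D.functorChi).obj M ⟶ M :=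
  ObjectProperty.homMk (Comod.Hom.mk
    (M := ((D.functorL ⋙ D.functorChi).obj M).obj) (N := M.obj) (D.equivL M).toLinearMap (by
      intro m
      refine (M.obj.coact_eq_sum (D.dualBasisL M) (D.equivL M m)).trans ?_
      simp only [coeff_eq_hatMk]
      change _ = BTensor.map (D.equivL M).toLinearMap LinearMap.id (BTensor.map LinearMap.id
        D.zetaHat.left (∑ j, BTensor.tmul A ((D.functorL.obj M).dualBasis.e j)
          (circMk (D.functorL.obj M) ((D.functorL.obj M).dualBasis.e' j) m)))
      rw [map_sum, map_sum]
      rfl))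

end

/-- The action of `R` on `ℒ'(χ'(N))` is that on `N`. -/
theorem comodAct_functorChi (N : FGPMod φ) (r : R) (m : N.toMod) :
    comodAct D.ξ (D.functorChi.obj N).obj r m = N.ract r m := by
  change actAux D.ξ N.toMod r (BTensor.map LinearMap.id D.zetaHat.left
    (∑ j, BTensor.tmul A (N.dualBasis.e j) (circMk N (N.dualBasis.e' j) m))) = _
  rw [map_sum, map_sum]
  refine Eq.trans (Finset.sum_congr rfl fun j _ => ?_) (N.dualBasis.sum_eq (N.ract r m))
  change op (D.ξ (D.zetaHat (circMk N (N.dualBasis.e' j) m)) r) • N.dualBasis.e j = _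
  rw [ξ_zetaHat, circZeta_circMk]

/-- The comparison `ℒ'(χ'(N)) ⟶ N`, the identity on underlying sets. -/
noncomputable def comparisonMod (N : FGPMod φ) : (D.functorChi ⋙ D.functorL).obj N ⟶ N :=
  ObjectProperty.homMk (ModuleCat.ofHom
    (X := ((D.functorChi ⋙ D.functorL).obj N).obj) (Y := N.obj)
    { toFun := fun m => m
      map_add' := fun _ _ => rfl
      map_smul' := fun r m => D.comodAct_functorChi N r.unop m })

end SaftDual

/-! ### Equality of functors -/

theorem functor_eq_id {𝒞 : Type*} [Category 𝒞] (F : 𝒞 ⥤ 𝒞) (θ : ∀ X, F.obj X ⟶ X)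
    (hθ : ∀ X, ∃ h : F.obj X = X, θ X = eqToHom h)
    (nat : ∀ {X Y : 𝒞} (f : X ⟶ Y), F.map f ≫ θ Y = θ X ≫ f) : F = 𝟭 𝒞 := by
  refine CategoryTheory.Functor.ext (fun X => (hθ X).choose) fun X Y f => ?_
  have h := nat f
  rw [(hθ X).choose_spec, (hθ Y).choose_spec] at h
  rw [Functor.id_map, ← Category.assoc, ← h, Category.assoc, eqToHom_trans, eqToHom_refl,
    Category.comp_id]

/-- A linear map between two module structures on the same group that is the identity on elements
exhibits an equality of modules. -/
theorem ModuleCat.exists_eqToHom {S : Type*} [Ring S] {V : Type u} [AddCommGroup V]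
    (m₁ m₂ : Module S V) (f : @ModuleCat.of S _ V _ m₁ ⟶ @ModuleCat.of S _ V _ m₂)
    (hf : ∀ v : V, f.hom v = v) :
    ∃ h : @ModuleCat.of S _ V _ m₁ = @ModuleCat.of S _ V _ m₂, f = eqToHom h := by
  obtain rfl : m₁ = m₂ := Module.ext' _ _ fun r v => by
    -- Linearity is stated for arbitrary modules, since `V` carries two module structures here.
    have h : ∀ {M N : ModuleCat.{u} S} (g : M ⟶ N) (x : M), g.hom (r • x) = r • g.hom x :=
      fun g x => g.hom.map_smul r x
    exact (hf _).symm.trans ((h f v).trans (congrArg (m₂.toSMul.smul r) (hf v)))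
  exact ⟨rfl, ModuleCat.hom_ext (LinearMap.ext hf)⟩

/-- A colinear map whose underlying linear map exhibits an equality of modules exhibits an equality
of comodules. -/
theorem Comod.exists_eqToHom {k A : Type u} [Field k] [CommRing A] [Algebra k A] {C : Coring k A}
    {M N : Comod C} (f : M ⟶ N)
    (hf : ∃ h : M.toMod = N.toMod, ModuleCat.ofHom (Comod.Hom.lin f) = eqToHom h) :
    ∃ h : M = N, f = eqToHom h := by
  obtain ⟨V, c, h1, h2⟩ := M
  obtain ⟨W, d, h3, h4⟩ := N
  obtain ⟨h, hf⟩ := hf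
  change V = W at h
  subst h
  have hl : f.lin = LinearMap.id := congrArg ModuleCat.Hom.hom hf
  obtain rfl : c = d := LinearMap.ext fun m => by
    have := f.colinear m
    rw [hl] at this
    exact (this.trans (BTensor.map_id _)).symm
  exact ⟨rfl, Comod.Hom.ext hl⟩

theorem ObjectProperty.exists_eqToHom {𝒞 : Type*} [Category 𝒞] {P : ObjectProperty 𝒞}
    {X Y : P.FullSubcategory} (f : X ⟶ Y) (hf : ∃ h : X.obj = Y.obj, f.hom = eqToHom h) :
    ∃ h : X = Y, f = eqToHom h := by
  obtain ⟨X, hX⟩ := X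
  obtain ⟨Y, hY⟩ := Y
  obtain ⟨h, hf⟩ := hf
  change X = Y at h
  subst h
  exact ⟨rfl, ObjectProperty.hom_ext _ hf⟩

namespace SaftDual

variable (D : SaftDual φ)

theorem functorL_comp_functorChi : D.functorL ⋙ D.functorChi = 𝟭 (FGPComod D.coring) := by
  refine functor_eq_id _ D.comparisonComod (fun M => ?_) fun f => ?_
  · exact ObjectProperty.exists_eqToHom _ (Comod.exists_eqToHom _
      (ModuleCat.exists_eqToHom (V := M.obj.toMod) _ _ _ fun _ => rfl))
  · exact ObjectProperty.hom_ext _ (Comod.Hom.ext rfl)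

theorem functorChi_comp_functorL : D.functorChi ⋙ D.functorL = 𝟭 (FGPMod φ) := by
  refine functor_eq_id _ D.comparisonMod (fun N => ?_) fun f => ?_
  · exact ObjectProperty.exists_eqToHom _
      (ModuleCat.exists_eqToHom (V := N.obj) _ _ _ fun _ => rfl)
  · rfl

end SaftDual
end Functors

end FiniteDual

theorem mainTheorem6 {k A R : Type u} [Field k] [CommRing A] [Algebra k A] [Ring R] [Algebra k R]
    (φ : A →ₐ[k] R) :
    Nonempty (FiniteDual.SaftDual φ) ∧
    ∀ D : FiniteDual.SaftDual φ,
      D.functorL ⋙ D.functorChi = 𝟭 (FiniteDual.FGPComod D.coring) ∧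
      D.functorChi ⋙ D.functorL = 𝟭 (FiniteDual.FGPMod φ) :=
  ⟨FiniteDual.nonempty_saftDual φ, fun D =>
    ⟨D.functorL_comp_functorChi, D.functorChi_comp_functorL⟩⟩
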